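/- Notation. For $d\ge 1$, $\mathcal M$ is the space of finite real (signed) Borel measures on $\mathbb R^d$, $\|\mu\|_1$ the total variation norm, $\mathcal F[f](\xi)=\int e^{-i\xi\cdot x}f(x)\,dx$ and $\mathcal F^{-1}$ its inverse. Let $\mu^0=\sum_{k=1}^K a_k^0\delta_{t_k}$ with $K\ge 1$, distinct points $t_k\in\mathbb R^d$, weights $a_k^0>0$, $\sum_k a_k^0=1$, and put $\Delta_+=\min(1,\min_{k\ne l}\|t_k-t_l\|_2)$ ($\Delta_+=1$ if $K=1$). Let $\varphi$ be a probability density on $\mathbb R^d$ and $\lambda:\mathbb R^d\to\mathbb R$, both bounded, continuous, symmetric and of positive definite type. Put $\sigma=\mathcal F[\varphi]$, $\Phi\mu=\varphi\star\mu$, $L\nu=\lambda\star\nu$, and let $\mathbb L$ be the reproducing kernel Hilbert space with kernel $(x,y)\mapsto\lambda(x-y)$; $L\nu\in\mathbb L$ for all $\nu\in\mathcal M$. Dual certificate. Let $\mathrm{sinc}(x)=\frac{\sin(x/2)}{x/2}$ (normalized so that $\mathcal F[\mathrm{sinc}]$ is supported by $[-\frac12,\frac12]$), $\psi(u)=\prod_{j=1}^d\mathrm{sinc}(u_j)$,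 $\psi_m(x)=\psi(mx)^4$ for an integer $m\ge 1$, and $P_m=p_m^2$ with $p_m(x)=\sum_{k=1}^K\{\alpha_k\psi_m(x-t_k)+\langle\beta_k,\nabla\psi_m(x-t_k)\rangle\}$, where the coefficients $\alpha_k\in\mathbb R$, $\beta_k\in\mathbb R^d$ are such that $p_m(t_k)=1$ and $\nabla p_m(t_k)=0$ for all $k$. Assume $\sigma(\xi)\ne 0$ for $\|\xi\|_\infty\le 4m$, and let $c_{0,m}$ be the function with $\mathcal F[c_{0,m}]=\frac{\mathcal F[P_m]}{\sigma}\mathbf 1_{\{\mathcal F[P_m]\ne 0\}}$. Proposition. There are a universal constant $C_0>0$ and, for each $d$, a constant $C_d>0$ depending on $d$ only, such that the following holds whenever $m\ge C_0\sqrt K\,d^{3/2}/\Delta_+$. i) Suppose $c_{0,m}\in\mathbb L$. Then $P_m=\Phi c_{0,m}$. Let $X_1,X_2,\dots$ be i.i.d. with density $f^0=\sum_k a_k^0\varphi(\cdot-t_k)$, $\hat f_n=\frac1n\sum_{i=1}^n\delta_{X_i}$ and $\Gamma_n=L\hat f_n-L\Phi\mu^0$. Let $(\rho_n)_{n\ge1}$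 be positive numbers with $\mathbb E\|\Gamma_n\|_{\mathbb L}^2\le\rho_n^2$ for all $n\ge 1$, put $\kappa=\kappa_n=\rho_n/\|c_{0,m}\|_{\mathbb L}$, and let $\hat\mu_n$ be any minimizer over $\mu\in\mathcal M$ of $\frac12\|L\hat f_n-L\Phi\mu\|_{\mathbb L}^2+\kappa\|\mu\|_1$. Then, for all $n\ge1$, the Bregman divergence $D_{P_m}(\hat\mu_n,\mu^0)=\|\hat\mu_n\|_1-\|\mu^0\|_1-\int P_m\,d(\hat\mu_n-\mu^0)$ is integrable and $$\mathbb E\big[D_{P_m}(\hat\mu_n,\mu^0)\big]\le\frac{3\sqrt2}{2}\,\rho_n\,\|c_{0,m}\|_{\mathbb L}.$$ ii) Suppose that $\lambda$ has a Fourier transform $\mathcal F[\lambda]$ that is a function, that is, $\lambda=\mathcal F^{-1}[\mathcal F[\lambda]]$ with $\mathcal F[\lambda]\ge 0$ integrable. If $\inf_{\|t\|_\infty\le 4m}\sigma^2(t)\mathcal F[\lambda](t)>0$, then $c_{0,m}\in\mathbb L$. If $c_{0,m}\in\mathbb L$, then the first inequality below holds, and the second one always holds (both right-hand sides are $+\infty$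 when the infimum vanishes): $$\|c_{0,m}\|_{\mathbb L}\le\sqrt{\frac{\|P_m\|_2^2}{\inf_{\|t\|_\infty\le 4m}\{\sigma^2(t)\mathcal F[\lambda](t)\}}},\qquad \sqrt{\frac{\|P_m\|_2^2}{\inf_{\|t\|_\infty\le 4m}\{\sigma^2(t)\mathcal F[\lambda](t)\}}}\le C_d\,\mathcal C_m(\varphi,\lambda),$$ where $$\mathcal C_m(\varphi,\lambda)=\frac{K^2m^{-d/2}}{\sqrt{\inf_{\|t\|_\infty\le 4m}\{\sigma^2(t)\mathcal F[\lambda](t)\}}}.$$ -/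

import Mathlib

open MeasureTheory ProbabilityTheory
open scoped ENNReal ComplexOrder ComplexConjugate

noncomputable section

namespace Blasso

/-- The space `ℝ^d` with its Euclidean structure. -/
abbrev E (d : ℕ) := EuclideanSpace ℝ (Fin d)

variable {d K : ℕ}

/-! ### Signed measures, convolution and Fourier transform -/

/-- The total variation norm `‖μ‖₁ = |μ|(ℝ^d)` of a real measure. -/
def tvNorm (μ : SignedMeasure (E d)) : ℝ := (μ.totalVariation Set.univ).toReal

/-- The function `φ ⋆ μ = ∫ φ(· - y) dμ(y)`. -/
def conv (φ : E d → ℝ) (μ : SignedMeasure (E d)) (x : E d) : ℝ := ∫ᵛ y, φ (x - y) ∂<•μ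

/-- The operator `Φ` on real measures: the real measure with Lebesgue density `φ ⋆ μ`. -/
def Phi (φ : E d → ℝ) (μ : SignedMeasure (E d)) : SignedMeasure (E d) :=
  volume.withDensityᵥ (conv φ μ)

/-- The operator `Φ` on functions: `φ ⋆ g`. -/
def convFun (φ g : E d → ℝ) (x : E d) : ℝ := ∫ y, φ (x - y) * g y

/-- The Fourier transform `F[f](ξ) = ∫ e^{-i ξ·x} f(x) dx`. -/
def fourier (f : E d → ℝ) (ξ : E d) : ℂ :=
  ∫ x, Complex.exp (-(Complex.I * (inner ℝ ξ x : ℝ))) * (f x : ℂ)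

/-- The inverse Fourier transform `F⁻¹[g](x) = (2π)^{-d} ∫ e^{i x·ξ} g(ξ) dξ`. -/
def fourierInv (g : E d → ℂ) (x : E d) : ℂ :=
  (((2 * Real.pi) ^ d : ℝ) : ℂ)⁻¹ * ∫ ξ, Complex.exp (Complex.I * (inner ℝ x ξ : ℝ)) * g ξ

/-- The spectral density `σ = F[φ]`; it is real valued because `φ` is even. -/
def sigma (φ : E d → ℝ) (ξ : E d) : ℝ := (fourier φ ξ).re

/-- The cube `[-η, η]^d`. -/
def cube (d : ℕ) (η : ℝ) : Set (E d) := {ξ | ∀ j, |ξ j| ≤ η}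

/-! ### Assumptions on the kernels -/

/-- Bounded continuous symmetric functions of positive definite type. -/
structure IsPosDefKernel (f : E d → ℝ) : Prop where
  bounded : ∃ B : ℝ, ∀ x, |f x| ≤ B
  continuous : Continuous f
  symm : ∀ x, f (-x) = f x
  posDef : ∀ (n : ℕ) (x : Fin n → E d) (z : Fin n → ℂ),
    0 ≤ ∑ i, ∑ j, (f (x i - x j) : ℂ) * z i * conj (z j)

/-- Probability densities with respect to the Lebesgue measure. -/
structure IsDensity (f : E d → ℝ) : Prop where
  nonneg : ∀ x, 0 ≤ f x
  integrable : Integrable f volume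
  integral_eq_one : ∫ x, f x = 1

/-- The cube `[-η, η]^d` lies in the set of points where `σ = F[φ]` does not vanish. (For a density
`φ` of positive definite type, `φ = F⁻¹[σ]` and the symmetry of `σ` hold automatically.) -/
def SpectrumContains (φ : E d → ℝ) (η : ℝ) : Prop := ∀ ξ ∈ cube d η, sigma φ ξ ≠ 0

/-- `s` is (a version of) the Fourier transform `F[lam]` of a kernel `lam` of positive definite
type: `s` is nonnegative and integrable, and `lam = F⁻¹[s]`. This also covers kernels which are not
integrable, such as the sinus-cardinal kernel. -/
structure IsFourierTransformOf (lam s : E d → ℝ) : Prop where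
  measurable : Measurable s
  nonneg : ∀ ξ, 0 ≤ s ξ
  integrable : Integrable s volume
  inversion : ∀ x, (lam x : ℂ) = fourierInv (fun ξ => (s ξ : ℂ)) x

/-! ### The reproducing kernel Hilbert space and the BLASSO estimator -/

section RKHS

variable (H : Type*) [NormedAddCommGroup H] [InnerProductSpace ℝ H] [CompleteSpace H]
  [RKHS ℝ H (E d) ℝ]

/-- The reproducing kernel of the Hilbert space of functions `H` is `(x, y) ↦ lam (x - y)`. -/
def HasKernel (lam : E d → ℝ) : Prop := ∀ x y : E d, RKHS.kernel H x y (1 : ℝ) = lam (x - y)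

/-- The element `lam (· - y)` of `H`. -/
def kerAt (y : E d) : H := RKHS.kerFun H y (1 : ℝ)

/-- The operator `L`, `L ν = lam ⋆ ν ∈ H`, as an integral with values in `H`
(see `L_apply` for its values). -/
def L (ν : SignedMeasure (E d)) : H := ∫ᵛ y, kerAt H y ∂<•ν

variable {H}

lemma kerAt_apply {lam : E d → ℝ} (h : HasKernel H lam) (x y : E d) :
    kerAt H y x = lam (x - y) := by
  rw [kerAt, RKHS.kerFun_apply, h]

lemma inner_kerAt (f : H) (x : E d) : inner ℝ f (kerAt H x) = f x := by
  simp [kerAt]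

lemma continuous_kerAt {lam : E d → ℝ} (hl : IsPosDefKernel lam) (h : HasKernel H lam) :
    Continuous (kerAt H : E d → H) := by
  rw [continuous_iff_continuousAt]
  intro x
  rw [ContinuousAt, tendsto_iff_norm_sub_tendsto_zero]
  have key : ∀ y, ‖kerAt H y - kerAt H x‖ = Real.sqrt (2 * lam 0 - 2 * lam (x - y)) := by
    intro y
    rw [← Real.sqrt_sq (norm_nonneg (kerAt H y - kerAt H x)), norm_sub_sq_real,
      ← real_inner_self_eq_norm_sq, ← real_inner_self_eq_norm_sq, inner_kerAt, inner_kerAt,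
      inner_kerAt, kerAt_apply h, kerAt_apply h, kerAt_apply h, sub_self, sub_self]
    congr 1
    ring
  have hc : Continuous fun y => Real.sqrt (2 * lam 0 - 2 * lam (x - y)) := by
    have := hl.continuous
    fun_prop
  have := hc.tendsto x
  simp only [sub_self, Real.sqrt_zero] at this
  exact this.congr fun y => (key y).symm

lemma norm_kerAt {lam : E d → ℝ} (h : HasKernel H lam) (x : E d) :
    ‖kerAt H x‖ = Real.sqrt (lam 0) := by
  rw [← Real.sqrt_sq (norm_nonneg (kerAt H x)), ← real_inner_self_eq_norm_sq, inner_kerAt,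
    kerAt_apply h, sub_self]

/-- `L ν` is the convolution `lam ⋆ ν`. -/
lemma L_apply {lam : E d → ℝ} (hl : IsPosDefKernel lam) (h : HasKernel H lam)
    (ν : SignedMeasure (E d)) (x : E d) : L H ν x = conv lam ν x := by
  have hfin : IsFiniteMeasure ν.variation := by
    rw [← SignedMeasure.totalVariation_eq_variation]
    infer_instance
  have hint : ν.Integrable (kerAt H : E d → H) :=
    Integrable.of_bound (continuous_kerAt hl h).aestronglyMeasurable (Real.sqrt (lam 0))
      (Filter.Eventually.of_forall fun y => (norm_kerAt h y).le)
  let C : H →L[ℝ] ℝ := innerSL ℝ (kerAt H x)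
  have hC : ∀ f : H, C f = f x := fun f => by
    simp only [C, innerSL_apply_apply]
    rw [real_inner_comm, inner_kerAt]
  have hk : ∀ y, C (kerAt H y) = lam (x - y) := fun y => by rw [hC, kerAt_apply h]
  rw [← hC, L, VectorMeasure.continuousLinearMap_apply_integral hint, conv]
  simp_rw [← hk]
  rw [VectorMeasure.integral_continuousLinearMap_comp hint]
  congr 1
  ext f
  simp

/-- `μ` minimizes the BLASSO criterion `½ ‖y - L Φ μ‖² + κ ‖μ‖₁` over all real measures. -/
def IsBlasso (φ : E d → ℝ) (y : H) (κ : ℝ) (μ : SignedMeasure (E d)) : Prop :=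
  ∀ ν : SignedMeasure (E d),
    (1 / 2) * ‖y - L H (Phi φ μ)‖ ^ 2 + κ * tvNorm μ
      ≤ (1 / 2) * ‖y - L H (Phi φ ν)‖ ^ 2 + κ * tvNorm ν

end RKHS

/-! ### The statistical model -/

/-- The discrete measure `μ⁰ = ∑ a_k δ_{t_k}`. -/
def mixing (a : Fin K → ℝ) (t : Fin K → E d) : SignedMeasure (E d) :=
  ∑ k, VectorMeasure.dirac (t k) (a k)

/-- The mixture density `f⁰ = ∑ a_k φ(· - t_k)`. -/
def mixtureDensity (φ : E d → ℝ) (a : Fin K → ℝ) (t : Fin K → E d) (x : E d) : ℝ :=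
  ∑ k, a k * φ (x - t k)

/-- The empirical measure of the points `x 0, …, x (n - 1)`. -/
def empirical (n : ℕ) (x : ℕ → E d) : SignedMeasure (E d) :=
  (n : ℝ)⁻¹ • ∑ i ∈ Finset.range n, VectorMeasure.dirac (x i) (1 : ℝ)

/-- `Δ₊ = min (1, min_{k ≠ l} ‖t_k - t_l‖₂)`, equal to `1` if there is only one point. -/
def sepPlus (t : Fin K → E d) : ℝ :=
  sInf (insert 1 {r : ℝ | ∃ k l, k ≠ l ∧ r = ‖t k - t l‖})

/-- The Bregman divergence `D_P(μ, ν) = ‖μ‖₁ - ‖ν‖₁ - ∫ P d(μ - ν)`. -/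
def bregman (P : E d → ℝ) (μ ν : SignedMeasure (E d)) : ℝ :=
  tvNorm μ - tvNorm ν - ∫ᵛ x, P x ∂<•(μ - ν)

/-! ### The dual certificate -/

/-- `ψ(u) = ∏ sinc(u_j)`, where the sinus cardinal is normalized so that its Fourier transform
`∫ e^{-iξx} sinc(x) dx` is supported by `[-1/2, 1/2]`: it is `sin(x/2)/(x/2)`. -/
def psi (u : E d) : ℝ := ∏ j, Real.sinc (u j / 2)

/-- `ψ_m = ψ⁴(m ·)`. -/
def psiM (m : ℕ) (x : E d) : ℝ := psi ((m : ℝ) • x) ^ 4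

/-- `p_m = ∑_k α_k ψ_m(· - t_k) + ⟨β_k, ∇ψ_m(· - t_k)⟩`. -/
def certRoot (m : ℕ) (t : Fin K → E d) (α : Fin K → ℝ) (β : Fin K → E d) (x : E d) : ℝ :=
  ∑ k, (α k * psiM m (x - t k) + inner ℝ (β k) (gradient (psiM m) (x - t k)))

/-- The coefficients `(α, β)` solve the interpolation system `p_m(t_k) = 1`, `∇p_m(t_k) = 0`. -/
def Interpolates (m : ℕ) (t : Fin K → E d) (α : Fin K → ℝ) (β : Fin K → E d) : Prop :=
  ∀ k, certRoot m t α β (t k) = 1 ∧ gradient (certRoot m t α β) (t k) = 0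

/-- The dual certificate `P_m = p_m²`. -/
def cert (m : ℕ) (t : Fin K → E d) (α : Fin K → ℝ) (β : Fin K → E d) (x : E d) : ℝ :=
  certRoot m t α β x ^ 2

/-- The function `c` with `F[c] = (F[P] / σ) 1_{F[P] ≠ 0}`. -/
def preimage (φ P : E d → ℝ) (x : E d) : ℝ :=
  (fourierInv ({ξ | fourier P ξ ≠ 0}.indicator fun ξ => fourier P ξ / (sigma φ ξ : ℂ)) x).re

/-- `inf_{‖ξ‖_∞ ≤ 4m} σ²(ξ) s(ξ)`, as an extended nonnegative number. -/
def specInf (φ s : E d → ℝ) (m : ℕ) : ℝ≥0∞ :=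
  ⨅ ξ ∈ cube d (4 * m), ENNReal.ofReal (sigma φ ξ ^ 2 * s ξ)

/-- `C_m(φ, lam) = K² m^{-d/2} / √(inf_{‖ξ‖_∞ ≤ 4m} σ²(ξ) F[lam](ξ))` with `s = F[lam]`; it is
infinite if the infimum vanishes. -/
def constCm (K : ℕ) (φ s : E d → ℝ) (m : ℕ) : ℝ≥0∞ :=
  ENNReal.ofReal ((K : ℝ) ^ 2 * (m : ℝ) ^ (-(d : ℝ) / 2)) / specInf φ s m ^ (1 / 2 : ℝ)

end Blasso

end

open Blasso

/-! ### Integrals against signed measures, and the adjoint of `L ∘ Φ`. -/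

namespace Blasso

variable {d K : ℕ}

/-! Part i) is a source-condition argument. Fubini and the reproducing property give `⟨c, L Φ ν⟩ = ∫
(φ ⋆ c) dν` (`inner_L_Phi`), so when `P = φ ⋆ c` the Bregman divergence involves the estimator only
through its total variation and its image `L Φ μ`. Comparing the criterion at the minimizer and at
`μ⁰` and completing a square gives `κ D ≤ ½ (‖Γ‖ + κ ‖c‖)²` (`IsBlasso.mul_bregman_le`). With `κ ‖c‖
= ρ` the expectation is at most `2 ρ ‖c‖`, and `2 ≤ 3√2/2`.

The minimizer is an arbitrary selection, possibly not measurable in the data. Its image and its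
total variation nevertheless vary in a Lipschitz way with bounded data, so `D` is a continuous
function of `L f̂_n`, hence measurable and integrable (`integral_bregman_le`).

That `P_m = Φ c₀` is deconvolution: `P_m` is integrable with spectrum in the cube of half-side `4m`,
where `σ ≠ 0`, so `F[P_m] / σ` is integrable and `φ ⋆ F⁻¹[F[P_m] / σ] = P_m` (`convFun_preimage`).
The spectrum is located by writing `P_m` as a superposition of characters with frequencies in the
cube (`Band`); Gaussian regularization shows that the transform of such an integrable function
vanishes elsewhere (`Band.fourier_eq_zero`).

For part ii), the norm in the RKHS of a combination of kernel functions is an `L²(F[λ])` norm of a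
trigonometric polynomial. Cauchy–Schwarz and Plancherel then bound the linear form attached to `c₀`,
and Hahn–Banach with Riesz gives both membership and the norm bound (`exists_RKHS_eq_preimage`).
Finally `‖P_m‖₂` is estimated: separation makes the interpolation system diagonally dominant, so
`α_k` and `m β_k` are bounded by `2` (`coeff_le_two`), and the decay of `sinc⁴` and its derivatives
gives `‖P_m‖₂² ≤ C K⁴ m^{-d}` (`integral_cert_sq_le`). -/

instance isFiniteMeasure_variation (ν : SignedMeasure (E d)) : IsFiniteMeasure ν.variation := by
  rw [← SignedMeasure.totalVariation_eq_variation]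
  infer_instance

lemma integrable_of_continuous_bounded {G : Type*} [NormedAddCommGroup G]
    (μ : Measure (E d)) [IsFiniteMeasure μ] {f : E d → G} (hf : Continuous f) {B : ℝ}
    (hB : ∀ x, ‖f x‖ ≤ B) : Integrable f μ :=
  Integrable.of_bound hf.aestronglyMeasurable B (Filter.Eventually.of_forall hB)

/-- The Jordan decomposition reduces vector-measure integrals to integrals against finite positive
measures, for which Fubini is available. -/
lemma integral_eq_posPart_sub_negPart (ν : SignedMeasure (E d)) {f : E d → ℝ}
    (hf : Continuous f) {B : ℝ} (hB : ∀ x, ‖f x‖ ≤ B) :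
    ∫ᵛ x, f x ∂<•ν = ∫ x, f x ∂ν.toJordanDecomposition.posPart
      - ∫ x, f x ∂ν.toJordanDecomposition.negPart := by
  conv_lhs => rw [← SignedMeasure.toSignedMeasure_toJordanDecomposition ν,
    JordanDecomposition.toSignedMeasure]
  rw [VectorMeasure.integral_sub_vectorMeasure, VectorMeasure.integral_toSignedMeasure,
    VectorMeasure.integral_toSignedMeasure]
  all_goals exact integrable_of_continuous_bounded _ hf hB

lemma integral_withDensityᵥ {f g : E d → ℝ} (hg : Integrable g) (hf : Continuous f) {B : ℝ}
    (hB : ∀ x, ‖f x‖ ≤ B) :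
    ∫ᵛ x, f x ∂<•(volume.withDensityᵥ g) = ∫ x, g x * f x := by
  have h1 := isFiniteMeasure_withDensity_ofReal hg.2
  have h2 := isFiniteMeasure_withDensity_ofReal hg.neg.2
  simp only [Pi.neg_apply] at h2
  rw [withDensityᵥ_eq_withDensity_pos_part_sub_withDensity_neg_part hg,
    VectorMeasure.integral_sub_vectorMeasure, VectorMeasure.integral_toSignedMeasure,
    VectorMeasure.integral_toSignedMeasure,
    integral_withDensity_eq_integral_toReal_smul₀ hg.aemeasurable.ennreal_ofReal (by simp),
    integral_withDensity_eq_integral_toReal_smul₀ (f := fun x => ENNReal.ofReal (-g x))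
      hg.neg.aemeasurable.ennreal_ofReal (by simp),
    ← integral_sub]
  · congr 1
    ext x
    simp only [smul_eq_mul, ← sub_mul]
    congr 1
    rw [ENNReal.toReal_ofReal', ENNReal.toReal_ofReal', max_zero_sub_max_neg_zero_eq_self]
  · exact (hg.real_toNNReal.mul_bdd hf.aestronglyMeasurable (Filter.Eventually.of_forall hB))
  · exact (hg.neg.real_toNNReal.mul_bdd hf.aestronglyMeasurable (Filter.Eventually.of_forall hB))
  all_goals exact integrable_of_continuous_bounded _ hf hB

section fubini

variable {φ : E d → ℝ}

lemma integrable_prod_conv (hφ : IsDensity φ) (hφ' : IsPosDefKernel φ) (p : Measure (E d))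
    [IsFiniteMeasure p] :
    Integrable (fun z : E d × E d => φ (z.1 - z.2)) (volume.prod p) := by
  rw [integrable_prod_iff' (by have := hφ'.continuous; fun_prop : Continuous _).aestronglyMeasurable]
  refine ⟨Filter.Eventually.of_forall fun y => hφ.integrable.comp_sub_right y, ?_⟩
  have : ∀ y, ∫ x, ‖φ (x - y)‖ = ∫ x, ‖φ x‖ := fun y =>
    integral_sub_right_eq_self (fun x => ‖φ x‖) y
  simp only [this]
  exact integrable_const _

/-- Fubini exchanges the integrals, and the evenness of `φ` makes convolution by `φ` its own
adjoint. -/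
lemma integral_conv_mul (hφ : IsDensity φ) (hφ' : IsPosDefKernel φ) (p : Measure (E d))
    [IsFiniteMeasure p] {g : E d → ℝ} (hg : Continuous g) {B : ℝ} (hB : ∀ x, ‖g x‖ ≤ B) :
    ∫ y, (∫ x, φ (y - x) ∂p) * g y = ∫ x, convFun φ g x ∂p := by
  have h : Integrable (fun z : E d × E d => φ (z.1 - z.2) * g z.1) (volume.prod p) :=
    (integrable_prod_conv hφ hφ' p).mul_bdd
      (by fun_prop : Continuous fun z : E d × E d => g z.1).aestronglyMeasurable
      (Filter.Eventually.of_forall fun z => hB z.1)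
  have := integral_integral_swap (f := fun y x => φ (y - x) * g y) h
  simp only [integral_mul_const] at this
  rw [this]
  congr 1
  ext x
  rw [convFun]
  congr 1
  ext y
  rw [← hφ'.symm (x - y), neg_sub]

lemma conv_eq (hφ' : IsPosDefKernel φ) (ν : SignedMeasure (E d)) (y : E d) :
    conv φ ν y = ∫ x, φ (y - x) ∂ν.toJordanDecomposition.posPart
      - ∫ x, φ (y - x) ∂ν.toJordanDecomposition.negPart := by
  obtain ⟨B, hB⟩ := hφ'.bounded
  have := hφ'.continuous
  exact integral_eq_posPart_sub_negPart ν (by fun_prop) (B := B) fun x => hB _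

lemma integrable_conv (hφ : IsDensity φ) (hφ' : IsPosDefKernel φ) (ν : SignedMeasure (E d)) :
    Integrable (conv φ ν) := by
  rw [funext (conv_eq hφ' ν)]
  exact (integrable_prod_conv hφ hφ' _).integral_prod_left.sub
    (integrable_prod_conv hφ hφ' _).integral_prod_left

lemma conv_add (hφ' : IsPosDefKernel φ) (μ ν : SignedMeasure (E d)) :
    conv φ (μ + ν) = conv φ μ + conv φ ν := by
  obtain ⟨B, hB⟩ := hφ'.bounded
  have := hφ'.continuous
  ext x
  exact VectorMeasure.integral_add_vectorMeasure
    (integrable_of_continuous_bounded _ (by fun_prop) (B := B) fun y => hB _)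
    (integrable_of_continuous_bounded _ (by fun_prop) (B := B) fun y => hB _)

lemma conv_smul (c : ℝ) (μ : SignedMeasure (E d)) : conv φ (c • μ) = c • conv φ μ := by
  ext x
  exact VectorMeasure.integral_smul_vectorMeasure _ _

lemma Phi_add (hφ : IsDensity φ) (hφ' : IsPosDefKernel φ) (μ ν : SignedMeasure (E d)) :
    Phi φ (μ + ν) = Phi φ μ + Phi φ ν := by
  rw [Phi, conv_add hφ', withDensityᵥ_add (integrable_conv hφ hφ' μ) (integrable_conv hφ hφ' ν)]
  rfl

lemma Phi_smul (c : ℝ) (μ : SignedMeasure (E d)) : Phi φ (c • μ) = c • Phi φ μ := by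
  rw [Phi, conv_smul, withDensityᵥ_smul]
  rfl

end fubini

section RKHS

variable {H : Type*} [NormedAddCommGroup H] [InnerProductSpace ℝ H] [CompleteSpace H]
  [RKHS ℝ H (E d) ℝ] {φ lam : E d → ℝ}

lemma integrable_kerAt (hl : IsPosDefKernel lam) (h : HasKernel H lam)
    (ν : SignedMeasure (E d)) : ν.Integrable (kerAt H : E d → H) :=
  integrable_of_continuous_bounded _ (continuous_kerAt hl h) fun y => (norm_kerAt h y).le

lemma L_add (hl : IsPosDefKernel lam) (h : HasKernel H lam) (μ ν : SignedMeasure (E d)) :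
    L H (μ + ν) = L H μ + L H ν :=
  VectorMeasure.integral_add_vectorMeasure (integrable_kerAt hl h μ) (integrable_kerAt hl h ν)

lemma L_smul (c : ℝ) (μ : SignedMeasure (E d)) : L H (c • μ) = c • L H μ :=
  VectorMeasure.integral_smul_vectorMeasure _ _

lemma continuous_coe_RKHS (hl : IsPosDefKernel lam) (h : HasKernel H lam) (c : H) :
    Continuous fun x => c x := by
  have := continuous_kerAt hl h
  simp_rw [← inner_kerAt c]
  fun_prop

lemma norm_coe_RKHS_le (h : HasKernel H lam) (c : H) (x : E d) :
    ‖c x‖ ≤ ‖c‖ * Real.sqrt (lam 0) := by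
  rw [← inner_kerAt c x, ← norm_kerAt h x]
  exact norm_inner_le_norm _ _

/-- The inner product passes inside the Bochner integral defining `L`, where the reproducing
property turns `⟨c, kerAt y⟩` into `c y`. -/
lemma inner_L (hl : IsPosDefKernel lam) (h : HasKernel H lam) (c : H)
    (ν : SignedMeasure (E d)) : inner ℝ c (L H ν) = ∫ᵛ x, c x ∂<•ν := by
  have hint := integrable_kerAt hl h ν
  have key := VectorMeasure.continuousLinearMap_apply_integral hint
    (B := (ContinuousLinearMap.lsmul ℝ ℝ).flip) (C := innerSL ℝ c)
  have hk : ∀ y, innerSL ℝ c (kerAt H y) = c y := fun y => inner_kerAt c y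
  rw [L, ← innerSL_apply_apply ℝ, key]
  simp_rw [← hk]
  rw [VectorMeasure.integral_continuousLinearMap_comp hint]
  congr 1
  ext f
  simp

/-- The adjoint relation `⟨c, L Φ ν⟩ = ∫ (φ ⋆ c) dν`. -/
lemma inner_L_Phi (hφ : IsDensity φ) (hφ' : IsPosDefKernel φ) (hl : IsPosDefKernel lam)
    (h : HasKernel H lam) (c : H) (ν : SignedMeasure (E d))
    (hc : Continuous (convFun φ c)) {B : ℝ} (hB : ∀ x, ‖convFun φ c x‖ ≤ B) :
    inner ℝ c (L H (Phi φ ν)) = ∫ᵛ x, convFun φ c x ∂<•ν := by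
  have h1 := continuous_coe_RKHS hl h c
  have h2 := norm_coe_RKHS_le h c
  rw [inner_L hl h, Phi, integral_withDensityᵥ (integrable_conv hφ hφ' ν) h1 h2,
    integral_eq_posPart_sub_negPart ν hc hB]
  simp_rw [conv_eq hφ', sub_mul]
  rw [integral_sub, integral_conv_mul hφ hφ' _ h1 h2, integral_conv_mul hφ hφ' _ h1 h2]
  all_goals exact ((integrable_prod_conv hφ hφ' _).integral_prod_left.mul_bdd
      h1.aestronglyMeasurable (Filter.Eventually.of_forall h2))

end RKHS

lemma tvNorm_eq (μ : SignedMeasure (E d)) : tvNorm μ = μ.variation.real Set.univ := by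
  rw [tvNorm, SignedMeasure.totalVariation_eq_variation]
  rfl

lemma tvNorm_nonneg (μ : SignedMeasure (E d)) : 0 ≤ tvNorm μ := ENNReal.toReal_nonneg

lemma tvNorm_zero : tvNorm (0 : SignedMeasure (E d)) = 0 := by simp [tvNorm_eq]

lemma tvNorm_add_le (μ ν : SignedMeasure (E d)) : tvNorm (μ + ν) ≤ tvNorm μ + tvNorm ν := by
  rw [tvNorm_eq, tvNorm_eq, tvNorm_eq, ← measureReal_add_apply]
  exact ENNReal.toReal_mono (measure_ne_top _ _) (VectorMeasure.variation_add_le _)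

lemma tvNorm_smul (c : ℝ) (μ : SignedMeasure (E d)) : tvNorm (c • μ) = |c| * tvNorm μ := by
  rw [tvNorm_eq, tvNorm_eq, VectorMeasure.variation_smul, measureReal_nnreal_smul_apply]
  simp

end Blasso

/-! ### Optimality and stability of BLASSO minimizers. -/

namespace Blasso

variable {d K : ℕ} {H : Type*} [NormedAddCommGroup H] [InnerProductSpace ℝ H] [CompleteSpace H]
  [RKHS ℝ H (E d) ℝ] {φ lam : E d → ℝ}

section blasso

variable {y y' : H} {κ : ℝ} {μ μ' : SignedMeasure (E d)}

/-- First-order optimality: the criterion is compared along the segment from `μ` to `ν`, where total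
variation is convex and the quadratic term contributes only order `s²`; divide by `s` and let `s →
0`. -/
lemma IsBlasso.inner_le (hφ : IsDensity φ) (hφ' : IsPosDefKernel φ) (hl : IsPosDefKernel lam)
    (h : HasKernel H lam) (hκ : 0 ≤ κ) (hμ : IsBlasso φ y κ μ) (ν : SignedMeasure (E d)) :
    inner ℝ (y - L H (Phi φ μ)) (L H (Phi φ ν) - L H (Phi φ μ)) ≤ κ * (tvNorm ν - tvNorm μ) := by
  set z := L H (Phi φ μ) with hz
  set z' := L H (Phi φ ν) with hz'
  have key : ∀ s : ℝ, 0 < s → s ≤ 1 →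
      inner ℝ (y - z) (z' - z) ≤ κ * (tvNorm ν - tvNorm μ) + s * (1 / 2 * ‖z' - z‖ ^ 2) := by
    intro s hs hs1
    have h1 := hμ ((1 - s) • μ + s • ν)
    have h2 : y - L H (Phi φ ((1 - s) • μ + s • ν)) = (y - z) - s • (z' - z) := by
      rw [Phi_add hφ hφ', Phi_smul, Phi_smul, L_add hl h, L_smul, L_smul, ← hz, ← hz']
      module
    have h3 : tvNorm ((1 - s) • μ + s • ν) ≤ (1 - s) * tvNorm μ + s * tvNorm ν := by
      refine (tvNorm_add_le _ _).trans_eq ?_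
      rw [tvNorm_smul, tvNorm_smul, abs_of_nonneg hs.le, abs_of_nonneg (by linarith)]
    rw [← hz, h2, norm_sub_sq_real (y - z) (s • (z' - z)), norm_smul, inner_smul_right, mul_pow, Real.norm_eq_abs, sq_abs] at h1
    have h4 := mul_le_mul_of_nonneg_left h3 hκ
    refine le_of_mul_le_mul_left ?_ hs
    linear_combination h1 + h4
  refine le_of_forall_pos_le_add fun ε hε => ?_
  set A := 1 / 2 * ‖z' - z‖ ^ 2 with hA
  have hA0 : 0 ≤ A := by positivity
  -- This `s` makes the remainder `s * A` at most `ε`; the denominator `A + 1` covers `A = 0`.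
  refine (key (min 1 (ε / (A + 1))) (by positivity) (min_le_left _ _)).trans ?_
  gcongr
  calc min 1 (ε / (A + 1)) * A ≤ ε / (A + 1) * A := by gcongr; exact min_le_right _ _
    _ ≤ ε := by rw [div_mul_eq_mul_div, div_le_iff₀ (by positivity)]; nlinarith

/-- The fitted image is a proximal point of the data, and proximal maps are nonexpansive: add the
two variational inequalities and apply Cauchy–Schwarz. -/
lemma IsBlasso.norm_sub_le (hφ : IsDensity φ) (hφ' : IsPosDefKernel φ) (hl : IsPosDefKernel lam)
    (h : HasKernel H lam) (hκ : 0 ≤ κ) (hμ : IsBlasso φ y κ μ) (hμ' : IsBlasso φ y' κ μ') :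
    ‖L H (Phi φ μ) - L H (Phi φ μ')‖ ≤ ‖y - y'‖ := by
  have h1 := hμ.inner_le hφ hφ' hl h hκ μ'
  have h2 := hμ'.inner_le hφ hφ' hl h hκ μ
  set z := L H (Phi φ μ)
  set z' := L H (Phi φ μ')
  have h3 : ‖z - z'‖ ^ 2 ≤ inner ℝ (y - y') (z - z') := by
    have e : inner ℝ (y - z) (z' - z) + inner ℝ (y' - z') (z - z')
        = ‖z - z'‖ ^ 2 - inner ℝ (y - y') (z - z') := by
      rw [← real_inner_self_eq_norm_sq, ← neg_sub z z', inner_neg_right]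
      simp only [inner_sub_left]
      ring
    linarith
  have h4 := h3.trans (real_inner_le_norm _ _)
  rcases (norm_nonneg (z - z')).eq_or_lt with h0 | h0
  · rw [← h0]; positivity
  · rw [sq] at h4
    exact le_of_mul_le_mul_right h4 h0

lemma Phi_zero : Phi φ (0 : SignedMeasure (E d)) = 0 := by
  have := Phi_smul (φ := φ) 0 0
  simpa using this

lemma L_zero : L H (0 : SignedMeasure (E d)) = 0 := by
  have := L_smul (H := H) 0 0
  simpa using this

lemma IsBlasso.norm_residual_sq_add_le (hμ : IsBlasso φ y κ μ) :
    1 / 2 * ‖y - L H (Phi φ μ)‖ ^ 2 + κ * tvNorm μ ≤ 1 / 2 * ‖y‖ ^ 2 := by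
  have := hμ 0
  rwa [Phi_zero, L_zero, tvNorm_zero, mul_zero, add_zero, sub_zero] at this

lemma IsBlasso.norm_residual_le (hκ : 0 ≤ κ) (hμ : IsBlasso φ y κ μ) :
    ‖y - L H (Phi φ μ)‖ ≤ ‖y‖ := by
  have h1 := hμ.norm_residual_sq_add_le
  have h2 := mul_nonneg hκ (tvNorm_nonneg μ)
  exact le_of_sq_le_sq (by linarith) (norm_nonneg _)

/-- Although minimizers need not be unique, their total variation depends on the data only, and in a
locally Lipschitz way. This is what gives measurability of the divergence without measurability of
the selected minimizer. -/
lemma IsBlasso.tvNorm_sub_le (hφ : IsDensity φ) (hφ' : IsPosDefKernel φ)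
    (hl : IsPosDefKernel lam) (h : HasKernel H lam) (hκ : 0 < κ)
    (hμ : IsBlasso φ y κ μ) (hμ' : IsBlasso φ y' κ μ') :
    tvNorm μ - tvNorm μ' ≤ ‖y‖ / κ * ‖y - y'‖ := by
  have h1 := hμ.inner_le hφ hφ' hl h hκ.le μ'
  have h2 := hμ.norm_sub_le hφ hφ' hl h hκ.le hμ'
  have h3 := hμ.norm_residual_le hκ.le
  have h4 : -inner ℝ (y - L H (Phi φ μ)) (L H (Phi φ μ') - L H (Phi φ μ)) ≤ ‖y‖ * ‖y - y'‖ := by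
    rw [← inner_neg_right, neg_sub]
    refine (real_inner_le_norm _ _).trans ?_
    gcongr
  rw [div_mul_eq_mul_div, le_div_iff₀ hκ]
  linarith

/-- The deterministic bound on the Bregman divergence of a BLASSO solution. -/
lemma IsBlasso.mul_bregman_le (hκ : 0 ≤ κ) (hμ : IsBlasso φ y κ μ) (c : H)
    (ν : SignedMeasure (E d)) :
    κ * (tvNorm μ - tvNorm ν - (inner ℝ c (L H (Phi φ μ)) - inner ℝ c (L H (Phi φ ν))))
      ≤ 1 / 2 * ‖y - L H (Phi φ ν)‖ ^ 2 + κ * ‖c‖ * ‖y - L H (Phi φ ν)‖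
        + 1 / 2 * (κ * ‖c‖) ^ 2 := by
  have h1 := hμ ν
  set z := L H (Phi φ μ)
  set z₀ := L H (Phi φ ν)
  have e : inner ℝ c z - inner ℝ c z₀ = inner ℝ c (y - z₀) - inner ℝ c (y - z) := by
    simp only [inner_sub_right]; ring
  rw [e]
  have h2 : -inner ℝ c (y - z₀) ≤ ‖c‖ * ‖y - z₀‖ := by
    rw [← inner_neg_right, ← norm_neg (y - z₀)]
    exact real_inner_le_norm _ _
  have h3 : inner ℝ c (y - z) ≤ ‖c‖ * ‖y - z‖ := real_inner_le_norm _ _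
  have h4 := mul_le_mul_of_nonneg_left h2 hκ
  have h5 := mul_le_mul_of_nonneg_left h3 hκ
  -- The residual term `κ ‖c‖ ‖y - z‖ - ½ ‖y - z‖²` is at most `½ (κ ‖c‖)²`.
  nlinarith [sq_nonneg (‖y - z‖ - κ * ‖c‖)]

end blasso

/-! ### Empirical data and the bound in expectation. -/

lemma L_dirac (x : E d) : L H (VectorMeasure.dirac x (1 : ℝ)) = kerAt H x := by
  rw [L, VectorMeasure.integral_dirac]
  simp

lemma L_sum (hl : IsPosDefKernel lam) (h : HasKernel H lam) {ι : Type*} (s : Finset ι)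
    (μ : ι → SignedMeasure (E d)) : L H (∑ i ∈ s, μ i) = ∑ i ∈ s, L H (μ i) :=
  VectorMeasure.integral_finsetSum_vectorMeasure fun i _ => integrable_kerAt hl h (μ i)

lemma L_empirical (hl : IsPosDefKernel lam) (h : HasKernel H lam) (n : ℕ) (x : ℕ → E d) :
    L H (empirical n x) = (n : ℝ)⁻¹ • ∑ i ∈ Finset.range n, kerAt H (x i) := by
  rw [empirical, L_smul, L_sum hl h]
  simp_rw [L_dirac]

lemma norm_L_empirical_le (hl : IsPosDefKernel lam) (h : HasKernel H lam) {n : ℕ} (hn : 1 ≤ n)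
    (x : ℕ → E d) : ‖L H (empirical n x)‖ ≤ Real.sqrt (lam 0) := by
  have hn' : (0 : ℝ) < n := by exact_mod_cast hn
  rw [L_empirical hl h, norm_smul, Real.norm_of_nonneg (by positivity), inv_mul_le_iff₀ hn']
  refine (norm_sum_le _ _).trans_eq ?_
  simp [norm_kerAt h]

lemma stronglyMeasurable_L_empirical (hl : IsPosDefKernel lam) (h : HasKernel H lam) (n : ℕ)
    {Ω : Type*} [MeasurableSpace Ω] {X : ℕ → Ω → E d} (hX : ∀ i, Measurable (X i)) :
    StronglyMeasurable fun ω => L H (empirical n fun i => X i ω) := by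
  simp_rw [L_empirical hl h]
  refine StronglyMeasurable.const_smul ?_ _
  exact Finset.stronglyMeasurable_fun_sum _ fun i _ =>
    (continuous_kerAt hl h).comp_stronglyMeasurable (hX i).stronglyMeasurable

lemma bregman_eq (hφ : IsDensity φ) (hφ' : IsPosDefKernel φ) (hl : IsPosDefKernel lam)
    (h : HasKernel H lam) {P : E d → ℝ} (hP : Continuous P) {B : ℝ} (hB : ∀ x, ‖P x‖ ≤ B)
    {c : H} (hc : ∀ x, P x = convFun φ c x) (μ ν : SignedMeasure (E d)) :
    bregman P μ ν = tvNorm μ - tvNorm ν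
      - (inner ℝ c (L H (Phi φ μ)) - inner ℝ c (L H (Phi φ ν))) := by
  have hc' : P = convFun φ c := funext hc
  rw [bregman, VectorMeasure.integral_sub_vectorMeasure
    (integrable_of_continuous_bounded _ hP hB) (integrable_of_continuous_bounded _ hP hB),
    inner_L_Phi hφ hφ' hl h c μ (hc' ▸ hP) (hc' ▸ hB),
    inner_L_Phi hφ hφ' hl h c ν (hc' ▸ hP) (hc' ▸ hB), hc']

/-- The Bregman divergence of the BLASSO estimator, integrability and bound in expectation. -/
theorem integral_bregman_le (hφ : IsDensity φ) (hφ' : IsPosDefKernel φ) (hl : IsPosDefKernel lam)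
    (h : HasKernel H lam) {P : E d → ℝ} (hP : Continuous P) {B : ℝ} (hB : ∀ x, ‖P x‖ ≤ B)
    {c : H} (hc0 : c ≠ 0) (hc : ∀ x, P x = convFun φ c x) (ν : SignedMeasure (E d))
    {Ω : Type*} [MeasurableSpace Ω] (Pr : Measure Ω) [IsProbabilityMeasure Pr]
    {Y : Ω → H} (hY : StronglyMeasurable Y) {R : ℝ} (hR : ∀ ω, ‖Y ω‖ ≤ R)
    {ρ : ℝ} (hρ : 0 < ρ) (hΓ : ∫ ω, ‖Y ω - L H (Phi φ ν)‖ ^ 2 ∂Pr ≤ ρ ^ 2)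
    (μhat : Ω → SignedMeasure (E d)) (hμ : ∀ ω, IsBlasso φ (Y ω) (ρ / ‖c‖) (μhat ω)) :
    Integrable (fun ω => bregman P (μhat ω) ν) Pr ∧
      ∫ ω, bregman P (μhat ω) ν ∂Pr ≤ 2 * ρ * ‖c‖ := by
  have hcn : 0 < ‖c‖ := norm_pos_iff.2 hc0
  set κ := ρ / ‖c‖ with hκd
  have hκ : 0 < κ := by positivity
  have hκc : κ * ‖c‖ = ρ := by rw [hκd]; field_simp
  have hR0 : 0 ≤ R := by
    obtain ⟨ω⟩ : Nonempty Ω := Pr.nonempty_of_neZero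
    exact (norm_nonneg _).trans (hR ω)
  simp_rw [bregman_eq hφ hφ' hl h hP hB hc]
  set z₀ := L H (Phi φ ν)
  set D : Ω → ℝ := fun ω => tvNorm (μhat ω) - tvNorm ν
    - (inner ℝ c (L H (Phi φ (μhat ω))) - inner ℝ c z₀) with hD
  -- the divergence is a Lipschitz function of the data
  have hlip : ∀ ω ω', D ω - D ω' ≤ (R / κ + ‖c‖) * ‖Y ω - Y ω'‖ := by
    intro ω ω'
    have h1 := (hμ ω).tvNorm_sub_le hφ hφ' hl h hκ (hμ ω')
    have h2 := (hμ ω).norm_sub_le hφ hφ' hl h hκ.le (hμ ω')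
    have h3 : inner ℝ c (L H (Phi φ (μhat ω')) - L H (Phi φ (μhat ω))) ≤ ‖c‖ * ‖Y ω - Y ω'‖ := by
      refine (real_inner_le_norm _ _).trans ?_
      rw [norm_sub_rev]
      gcongr
    have h4 : ‖Y ω‖ / κ * ‖Y ω - Y ω'‖ ≤ R / κ * ‖Y ω - Y ω'‖ := by gcongr; exact hR ω
    rw [inner_sub_right] at h3
    simp only [hD]
    linarith
  -- The estimate `hlip` shows that `D` factors through `Y` as a Lipschitz function on the range of
  -- `Y`; a Lipschitz extension to all of `H` then avoids any measurability question about that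
  -- range.
  obtain ⟨G, hG, hDG⟩ : ∃ G : H → ℝ, Continuous G ∧ ∀ ω, D ω = G (Y ω) := by
    have hex : ∀ y ∈ Set.range Y, ∃ ω, Y ω = y := fun y hy => hy
    have : Nonempty Ω := Pr.nonempty_of_neZero
    choose! g hg using hex
    obtain ⟨G, hG, hEq⟩ := LipschitzOnWith.extend_real (f := fun y => D (g y)) (s := Set.range Y)
      (K := (R / κ + ‖c‖).toNNReal) (LipschitzOnWith.of_dist_le_mul fun x hx y hy => by
        rw [Real.coe_toNNReal _ (by positivity), Real.dist_eq, dist_eq_norm, abs_le]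
        have h1 := hlip (g x) (g y)
        have h2 := hlip (g y) (g x)
        rw [hg x hx, hg y hy] at h1 h2
        rw [norm_sub_rev] at h2
        constructor <;> linarith)
    refine ⟨G, hG.continuous, fun ω => ?_⟩
    have hm : Y ω ∈ Set.range Y := ⟨ω, rfl⟩
    rw [← hEq hm]
    have h1 := hlip (g (Y ω)) ω
    have h2 := hlip ω (g (Y ω))
    rw [hg _ hm, sub_self, norm_zero, mul_zero] at h1 h2
    show D ω = D (g (Y ω))
    linarith
  have hmeas : AEStronglyMeasurable D Pr := by
    rw [funext hDG]
    exact (hG.comp_stronglyMeasurable hY).aestronglyMeasurable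
  have hbdd : ∀ ω ω', ‖D ω‖ ≤ ‖D ω'‖ + (R / κ + ‖c‖) * (2 * R) := by
    intro ω ω'
    have hn : ‖Y ω - Y ω'‖ ≤ 2 * R := (norm_sub_le _ _).trans (by linarith [hR ω, hR ω'])
    have h1 := (hlip ω ω').trans (mul_le_mul_of_nonneg_left hn (by positivity))
    have h2 := hlip ω' ω
    rw [norm_sub_rev] at h2
    have h3 := h2.trans (mul_le_mul_of_nonneg_left hn (by positivity))
    have h4 : ‖D ω - D ω'‖ ≤ (R / κ + ‖c‖) * (2 * R) := by
      rw [Real.norm_eq_abs, abs_le]; constructor <;> linarith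
    have := norm_le_norm_add_norm_sub' (D ω) (D ω')
    linarith
  have hint : Integrable D Pr := by
    obtain ⟨ω'⟩ : Nonempty Ω := Pr.nonempty_of_neZero
    exact Integrable.of_bound hmeas _ (Filter.Eventually.of_forall fun ω => hbdd ω ω')
  refine ⟨hint, ?_⟩
  have hΓint : Integrable (fun ω => ‖Y ω - z₀‖ ^ 2) Pr := by
    refine Integrable.of_bound (C := (R + ‖z₀‖) ^ 2) ?_ (Filter.Eventually.of_forall fun ω => ?_)
    · exact ((hY.sub stronglyMeasurable_const).norm.pow 2).aestronglyMeasurable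
    · rw [norm_pow, norm_norm]
      gcongr
      exact (norm_sub_le _ _).trans (by linarith [hR ω])
  -- Since `κ ‖c‖ = ρ`, the deterministic bound is `κ D ≤ ½ (‖Γ‖ + ρ)²`, and this is at most `‖Γ‖² +
  -- ρ²`.
  have hle : ∀ ω, D ω ≤ κ⁻¹ * (‖Y ω - z₀‖ ^ 2 + ρ ^ 2) := by
    intro ω
    have h1 := (hμ ω).mul_bregman_le hκ.le c ν
    rw [hκc] at h1
    rw [← div_eq_inv_mul, le_div_iff₀ hκ]
    have h1' : κ * D ω ≤ _ := h1
    nlinarith [sq_nonneg (‖Y ω - z₀‖ - ρ)]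
  calc ∫ ω, D ω ∂Pr ≤ ∫ ω, κ⁻¹ * (‖Y ω - z₀‖ ^ 2 + ρ ^ 2) ∂Pr :=
        integral_mono hint ((hΓint.add (integrable_const _)).const_mul _) hle
    _ = κ⁻¹ * (∫ ω, ‖Y ω - z₀‖ ^ 2 ∂Pr + ρ ^ 2) := by
        rw [integral_const_mul, integral_add hΓint (integrable_const _)]
        simp
    _ ≤ κ⁻¹ * (ρ ^ 2 + ρ ^ 2) := by gcongr
    _ = 2 * ρ * ‖c‖ := by rw [hκd]; field_simp; ring

end Blasso

/-! ### Fourier inversion and Plancherel in the angular-frequency normalization. -/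

namespace Blasso

variable {d K : ℕ}

open scoped FourierTransform in
lemma fourierTransform_eq (f : E d → ℝ) (w : E d) :
    𝓕 (fun x => (f x : ℂ)) w = fourier f ((2 * Real.pi) • w) := by
  rw [Real.fourier_eq', fourier]
  congr 1
  ext x
  rw [smul_eq_mul, real_inner_smul_left, real_inner_comm]
  congr 2
  push_cast
  ring

open scoped FourierTransform in
lemma fourierTransformInv_eq (g : E d → ℂ) (x : E d) :
    𝓕⁻ (fun w => g ((2 * Real.pi) • w)) x = fourierInv g x := by
  rw [Real.fourierInv_eq', fourierInv]
  have h := Measure.integral_comp_smul (volume : Measure (E d))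
    (fun ξ => Complex.exp (Complex.I * (inner ℝ x ξ : ℝ)) * g ξ) (2 * Real.pi)
  rw [finrank_euclideanSpace_fin, abs_of_nonneg (by positivity), Complex.real_smul] at h
  rw [← Complex.ofReal_inv, ← h]
  congr 1
  ext w
  rw [smul_eq_mul, real_inner_smul_right, real_inner_comm]
  congr 2
  push_cast
  ring

open scoped FourierTransform in
lemma continuous_fourier {f : E d → ℝ} (hf : Integrable f) : Continuous (fourier f) := by
  have h1 : Continuous (𝓕 (fun x => (f x : ℂ))) :=
    VectorFourier.fourierIntegral_continuous Real.continuous_fourierChar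
      (L := innerₗ (E d)) continuous_inner hf.ofReal
  have h2 : fourier f = fun ξ => 𝓕 (fun x => (f x : ℂ)) ((2 * Real.pi)⁻¹ • ξ) := by
    ext ξ
    rw [fourierTransform_eq, smul_smul, mul_inv_cancel₀ (by positivity), one_smul]
  rw [h2]
  fun_prop

lemma isCompact_cube (η : ℝ) : IsCompact (cube d η) := by
  refine Metric.isCompact_of_isClosed_isBounded ?_ ?_
  · simp only [cube, Set.ofPred_forall]
    exact isClosed_iInter fun j => isClosed_le (by fun_prop) continuous_const
  · rw [isBounded_iff_forall_norm_le]
    refine ⟨√(∑ _j : Fin d, η ^ 2), fun x hx => ?_⟩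
    rw [EuclideanSpace.norm_eq]
    gcongr with j
    exact hx j

lemma measurableSet_cube (η : ℝ) : MeasurableSet (cube d η) := (isCompact_cube η).measurableSet

lemma integrable_of_continuousOn_cube {g : E d → ℂ} {η : ℝ} (hg : ContinuousOn g (cube d η))
    (h0 : ∀ ξ ∉ cube d η, g ξ = 0) : Integrable g := by
  have h1 := (hg.integrableOn_compact (isCompact_cube η) (μ := volume))
  rw [← integrable_indicator_iff (measurableSet_cube η)] at h1
  refine h1.congr (Filter.Eventually.of_forall fun ξ => ?_)
  by_cases h : ξ ∈ cube d η <;> simp [h, h0]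

lemma integrable_fourier {f : E d → ℝ} (hf : Integrable f) {η : ℝ}
    (h0 : ∀ ξ ∉ cube d η, fourier f ξ = 0) : Integrable (fourier f) :=
  integrable_of_continuousOn_cube (continuous_fourier hf).continuousOn h0

open scoped FourierTransform in
lemma integrable_fourierTransform {f : E d → ℝ} (h : Integrable (fourier f)) :
    Integrable (𝓕 (fun x => (f x : ℂ))) := by
  rw [show 𝓕 (fun x => (f x : ℂ)) = fun w => fourier f ((2 * Real.pi) • w) from
    funext (fourierTransform_eq f)]
  exact h.comp_smul (by positivity)

open scoped FourierTransform in
lemma fourierInv_fourier {f : E d → ℝ} (hf : Integrable f) (hc : Continuous f)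
    (h : Integrable (fourier f)) (x : E d) : fourierInv (fourier f) x = f x := by
  have h1 := (Complex.continuous_ofReal.comp hc).fourierInv_fourier_eq hf.ofReal
    (integrable_fourierTransform h)
  have h2 := congrFun h1 x
  rw [← fourierTransformInv_eq]
  simp_rw [← fourierTransform_eq]
  exact h2

-- The sesquilinear exchange formula moves one transform across the pairing, where it becomes an
-- inverse transform and cancels by inversion; the factor `(2π)^d` comes from rescaling frequencies.
open scoped FourierTransform in
lemma integral_norm_fourier_sq {f : E d → ℝ} (hf : Integrable f) (hc : Continuous f)
    (h : Integrable (fourier f)) :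
    ∫ ξ, ‖fourier f ξ‖ ^ 2 = (2 * Real.pi) ^ d * ∫ x, f x ^ 2 := by
  have hF := integrable_fourierTransform h
  have key := VectorFourier.integral_sesq_fourierIntegral_eq_neg_flip (innerSL ℂ)
    (L := innerₗ (E d)) Real.continuous_fourierChar continuous_inner
    (hf.ofReal : Integrable (fun x => (f x : ℂ))) hF
  have h1 := (Complex.continuous_ofReal.comp hc).fourierInv_fourier_eq hf.ofReal hF
  have h2 : ∫ w, inner ℂ (𝓕 (fun x => (f x : ℂ)) w) (𝓕 (fun x => (f x : ℂ)) w)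
      = ∫ x, inner ℂ (f x : ℂ) (f x : ℂ) := by
    refine Eq.trans key ?_
    congr 1
    ext x
    rw [flip_innerₗ]
    show inner ℂ (f x : ℂ) (𝓕⁻ (𝓕 (fun x => (f x : ℂ))) x) = _
    rw [show (𝓕⁻ (𝓕 (fun x => (f x : ℂ))) x) = (f x : ℂ) from congrFun h1 x]
  simp_rw [inner_self_eq_norm_sq_to_K] at h2
  have h3 : ∫ w, ‖𝓕 (fun x => (f x : ℂ)) w‖ ^ 2 = ∫ x, f x ^ 2 := by
    have := h2
    simp only [Complex.coe_algebraMap, Complex.norm_real, Real.norm_eq_abs] at this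
    norm_cast at this
    simpa using this
  simp_rw [fourierTransform_eq] at h3
  rw [Measure.integral_comp_smul volume (fun ξ => ‖fourier f ξ‖ ^ 2), finrank_euclideanSpace_fin,
    abs_of_nonneg (by positivity), smul_eq_mul] at h3
  rw [← h3, mul_inv_cancel_left₀ (by positivity)]

/-! ### Deconvolution of band-limited functions. -/

section deconvolution

variable {φ : E d → ℝ}

lemma fourier_eq_sigma (hφ : IsPosDefKernel φ) (ξ : E d) : fourier φ ξ = (sigma φ ξ : ℂ) := by
  have : conj (fourier φ ξ) = fourier φ ξ := by
    rw [fourier, ← integral_conj, ← integral_neg_eq_self]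
    congr 1
    ext x
    rw [map_mul, ← Complex.exp_conj, Complex.conj_ofReal, hφ.symm]
    simp
  rw [sigma, Complex.conj_eq_iff_re.1 this]

lemma continuous_sigma (hφ : IsDensity φ) : Continuous (sigma φ) :=
  Complex.continuous_re.comp (continuous_fourier hφ.integrable)

/-- The Fourier transform of `preimage φ P`. -/
noncomputable def preimageFourier (φ P : E d → ℝ) (ξ : E d) : ℂ := fourier P ξ / (sigma φ ξ : ℂ)

/-- The indicator can be dropped because `0 / σ = 0`, even where `σ` vanishes. -/
lemma preimage_eq (φ P : E d → ℝ) (x : E d) :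
    preimage φ P x = (fourierInv (preimageFourier φ P) x).re := by
  rw [preimage]
  congr 2
  ext ξ
  by_cases h : fourier P ξ = 0 <;> simp [preimageFourier, h]

lemma integrable_preimageFourier (hφ : IsDensity φ) {η : ℝ} (hσ : SpectrumContains φ η)
    {P : E d → ℝ} (hP : Integrable P) (h0 : ∀ ξ ∉ cube d η, fourier P ξ = 0) :
    Integrable (preimageFourier φ P) := by
  refine integrable_of_continuousOn_cube (η := η) ?_ fun ξ hξ => by simp [preimageFourier, h0 ξ hξ]
  refine (continuous_fourier hP).continuousOn.div ?_ fun ξ hξ => ?_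
  · exact (Complex.continuous_ofReal.comp (continuous_sigma hφ)).continuousOn
  · exact_mod_cast hσ ξ hξ

lemma norm_exp_I_mul (r : ℝ) : ‖Complex.exp (Complex.I * (r : ℂ))‖ = 1 := by
  rw [mul_comm, Complex.norm_exp_ofReal_mul_I]

/-- By Fubini, `φ ⋆ F⁻¹[G] = F⁻¹[σ G]`, and `σ G = F[P]`, so inversion recovers `P`. The real part
commutes with the convolution because `φ` is real. -/
lemma convFun_preimage (hφ : IsDensity φ) (hφ' : IsPosDefKernel φ) {η : ℝ}
    (hσ : SpectrumContains φ η) {P : E d → ℝ} (hP : Integrable P) (hPc : Continuous P)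
    (h0 : ∀ ξ ∉ cube d η, fourier P ξ = 0) (x : E d) :
    convFun φ (preimage φ P) x = P x := by
  set G := preimageFourier φ P with hG
  have hGi : Integrable G := integrable_preimageFourier hφ hσ hP h0
  have hφx : Integrable (fun y => (φ (x - y) : ℂ)) :=
    (hφ.integrable.comp_sub_left x).ofReal
  have hprod : Integrable (fun z : E d × E d =>
      (φ (x - z.1) : ℂ) * (Complex.exp (Complex.I * (inner ℝ z.1 z.2 : ℝ)) * G z.2))
      (volume.prod volume) := by
    have h1 := (hφx.mul_prod hGi).bdd_mul
      (f := fun z : E d × E d => Complex.exp (Complex.I * (inner ℝ z.1 z.2 : ℝ))) (c := 1)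
      (by fun_prop : Continuous _).aestronglyMeasurable
      (Filter.Eventually.of_forall fun z => (norm_exp_I_mul _).le)
    refine h1.congr (Filter.Eventually.of_forall fun z => ?_)
    simp only
    ring
  have hin : ∀ ξ, ∫ y, (φ (x - y) : ℂ) * (Complex.exp (Complex.I * (inner ℝ y ξ : ℝ)) * G ξ)
      = Complex.exp (Complex.I * (inner ℝ x ξ : ℝ)) * fourier P ξ := by
    intro ξ
    have h1 : ∀ y, (φ (x - y) : ℂ) * (Complex.exp (Complex.I * (inner ℝ y ξ : ℝ)) * G ξ)
        = (Complex.exp (Complex.I * (inner ℝ x ξ : ℝ)) * G ξ) *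
          (Complex.exp (-(Complex.I * (inner ℝ ξ (x - y) : ℝ))) * (φ (x - y) : ℂ)) := by
      intro y
      have : Complex.exp (Complex.I * (inner ℝ y ξ : ℝ)) =
          Complex.exp (Complex.I * (inner ℝ x ξ : ℝ)) *
          Complex.exp (-(Complex.I * (inner ℝ ξ (x - y) : ℝ))) := by
        rw [← Complex.exp_add, inner_sub_right, real_inner_comm x ξ, real_inner_comm y ξ]
        congr 1
        push_cast
        ring
      rw [this]
      ring
    simp_rw [h1]
    rw [integral_const_mul, integral_sub_left_eq_self
      (fun u => Complex.exp (-(Complex.I * (inner ℝ ξ u : ℝ))) * (φ u : ℂ)) volume x]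
    change _ * fourier φ ξ = _
    rw [fourier_eq_sigma hφ', mul_assoc, hG, preimageFourier]
    congr 1
    by_cases hξ : ξ ∈ cube d η
    · exact div_mul_cancel₀ _ (by exact_mod_cast hσ ξ hξ)
    · simp [h0 ξ hξ]
  have h2 : ∫ y, (φ (x - y) : ℂ) * fourierInv G y = P x := by
    have hswap := integral_integral_swap (f := fun y ξ =>
      (φ (x - y) : ℂ) * (Complex.exp (Complex.I * (inner ℝ y ξ : ℝ)) * G ξ)) hprod
    simp_rw [hin, integral_const_mul] at hswap
    rw [← fourierInv_fourier hP hPc (integrable_fourier hP h0) x]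
    simp only [fourierInv]
    rw [← hswap, ← integral_const_mul]
    congr 1
    ext y
    ring
  have h3 : Integrable fun y => (φ (x - y) : ℂ) * fourierInv G y := by
    have := (hprod.integral_prod_left).const_mul (((2 * Real.pi) ^ d : ℝ) : ℂ)⁻¹
    refine this.congr (Filter.Eventually.of_forall fun y => ?_)
    simp only [integral_const_mul, fourierInv]
    ring
  rw [convFun]
  have h4 := congrArg Complex.re h2
  rw [Complex.ofReal_re] at h4
  rw [← h4]
  rw [show (∫ y, (φ (x - y) : ℂ) * fourierInv G y).re
    = ∫ y, ((φ (x - y) : ℂ) * fourierInv G y).re from (integral_re h3).symm]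
  congr 1
  ext y
  rw [Complex.re_ofReal_mul, preimage_eq]

end deconvolution

/-! ### Superpositions of characters with frequencies in a box. -/

/-- `f` is a superposition of the characters `x ↦ e^{i x·v}` with `v` in the box `∏ [-η_j, η_j]`,
with respect to a finite measure on a parameter space. -/
def Band (η : Fin d → ℝ) (f : E d → ℂ) : Prop :=
  ∃ (Θ : Type) (_ : MeasurableSpace Θ) (μ : Measure Θ) (_ : IsFiniteMeasure μ) (v : Θ → E d)
    (c : Θ → ℂ), Measurable v ∧ Measurable c ∧ (∃ C, ∀ θ, ‖c θ‖ ≤ C) ∧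
    (∀ θ j, |v θ j| ≤ η j) ∧
    ∀ x, f x = ∫ θ, Complex.exp (Complex.I * (inner ℝ x (v θ) : ℝ)) * c θ ∂μ

namespace Band

variable {η η' : Fin d → ℝ} {f g : E d → ℂ}

lemma mono (hf : Band η f) (h : ∀ j, η j ≤ η' j) : Band η' f := by
  obtain ⟨Θ, _, μ, hμ, v, c, hv, hc, hC, hη, hfx⟩ := hf
  exact ⟨Θ, _, μ, hμ, v, c, hv, hc, hC, fun θ j => (hη θ j).trans (h j), hfx⟩

lemma const_mul (hf : Band η f) (a : ℂ) : Band η fun x => a * f x := by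
  obtain ⟨Θ, _, μ, hμ, v, c, hv, hc, ⟨C, hC⟩, hη, hfx⟩ := hf
  refine ⟨Θ, _, μ, hμ, v, fun θ => a * c θ, hv, hc.const_mul a, ⟨‖a‖ * C, fun θ => ?_⟩, hη,
    fun x => ?_⟩
  · rw [norm_mul]
    gcongr
    exact hC θ
  · beta_reduce
    rw [hfx, ← integral_const_mul]
    congr 1
    ext θ
    ring

lemma translate (hf : Band η f) (t : E d) : Band η fun x => f (x - t) := by
  obtain ⟨Θ, _, μ, hμ, v, c, hv, hc, ⟨C, hC⟩, hη, hfx⟩ := hf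
  refine ⟨Θ, _, μ, hμ, v, fun θ => Complex.exp (Complex.I * ((-inner ℝ t (v θ) : ℝ) : ℂ)) * c θ,
    hv, by fun_prop, ⟨C, fun θ => ?_⟩, hη, fun x => ?_⟩
  · rw [norm_mul, norm_exp_I_mul, one_mul]
    exact hC θ
  · beta_reduce
    rw [hfx]
    congr 1
    ext θ
    rw [← mul_assoc, ← Complex.exp_add, inner_sub_left]
    congr 2
    push_cast
    ring

lemma integrable_aux {Θ : Type} [MeasurableSpace Θ] (μ : Measure Θ) [IsFiniteMeasure μ]
    {v : Θ → E d} {c : Θ → ℂ} (hv : Measurable v) (hc : Measurable c) {C : ℝ}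
    (hC : ∀ θ, ‖c θ‖ ≤ C) (x : E d) :
    Integrable (fun θ => Complex.exp (Complex.I * (inner ℝ x (v θ) : ℝ)) * c θ) μ := by
  refine Integrable.of_bound (by fun_prop : Measurable _).aestronglyMeasurable C
    (Filter.Eventually.of_forall fun θ => ?_)
  rw [norm_mul, norm_exp_I_mul, one_mul]
  exact hC θ

/-- Multiplying characters adds frequencies. Keeping an abstract parameter space lets the product
measure play the role of a convolution of complex measures. -/
lemma mul (hf : Band η f) (hg : Band η' g) : Band (fun j => η j + η' j) fun x => f x * g x := by
  obtain ⟨Θ, _, μ, hμ, v, c, hv, hc, ⟨C, hC⟩, hη, hfx⟩ := hf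
  obtain ⟨Θ', _, μ', hμ', v', c', hv', hc', ⟨C', hC'⟩, hη', hgx⟩ := hg
  refine ⟨Θ × Θ', _, μ.prod μ', inferInstance, fun θ => v θ.1 + v' θ.2,
    fun θ => c θ.1 * c' θ.2, by fun_prop, by fun_prop, ⟨C * C', fun θ => ?_⟩, fun θ j => ?_,
    fun x => ?_⟩
  · rw [norm_mul]
    exact mul_le_mul (hC _) (hC' _) (norm_nonneg _) ((norm_nonneg _).trans (hC θ.1))
  · exact (abs_add_le _ _).trans (add_le_add (hη _ _) (hη' _ _))
  · beta_reduce
    rw [hfx, hgx, ← integral_prod_mul]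
    congr 1
    ext θ
    rw [inner_add_right]
    push_cast
    rw [mul_add, Complex.exp_add]
    ring

/-- The parameter space is the disjoint union of the two given ones. -/
lemma add (hf : Band η f) (hg : Band η g) : Band η fun x => f x + g x := by
  obtain ⟨Θ, _, μ, hμ, v, c, hv, hc, ⟨C, hC⟩, hη, hfx⟩ := hf
  obtain ⟨Θ', _, μ', hμ', v', c', hv', hc', ⟨C', hC'⟩, hη', hgx⟩ := hg
  have hm : Measurable (Sum.elim v v') := hv.sumElim hv'
  have hm' : Measurable (Sum.elim c c') := hc.sumElim hc'
  have hb : ∀ θ, ‖Sum.elim c c' θ‖ ≤ max C C' := by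
    rintro (θ | θ)
    · exact (hC θ).trans (le_max_left _ _)
    · exact (hC' θ).trans (le_max_right _ _)
  refine ⟨Θ ⊕ Θ', _, μ.map Sum.inl + μ'.map Sum.inr, inferInstance, Sum.elim v v',
    Sum.elim c c', hm, hm', ⟨max C C', hb⟩, ?_, fun x => ?_⟩
  · rintro (θ | θ) j
    · exact hη θ j
    · exact hη' θ j
  · beta_reduce
    rw [integral_add_measure (integrable_aux _ hm hm' hb x) (integrable_aux _ hm hm' hb x),
      integral_map measurable_inl.aemeasurable, integral_map measurable_inr.aemeasurable, hfx, hgx]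
    · rfl
    · exact (by fun_prop : Measurable _).aestronglyMeasurable
    · exact (by fun_prop : Measurable _).aestronglyMeasurable

lemma zero (hη : ∀ j, 0 ≤ η j) : Band η fun _ => 0 :=
  ⟨Unit, ⊤, 0, inferInstance, fun _ => 0, fun _ => 0, measurable_const, measurable_const,
    ⟨0, by simp⟩, by simpa using hη, by simp⟩

lemma one : Band (fun _ : Fin d => 0) fun _ => 1 :=
  ⟨Unit, ⊤, Measure.dirac (), inferInstance, fun _ => 0, fun _ => 1, measurable_const,
    measurable_const, ⟨1, by simp⟩, by simp, by simp⟩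

lemma sum (hη : ∀ j, 0 ≤ η j) {ι : Type*} (s : Finset ι) {F : ι → E d → ℂ}
    (hF : ∀ i, Band η (F i)) : Band η fun x => ∑ i ∈ s, F i x := by
  classical
  induction s using Finset.induction_on with
  | empty => simpa using zero hη
  | insert i s hi ih =>
    simp_rw [Finset.sum_insert hi]
    exact (hF i).add ih

lemma prod {ι : Type*} (s : Finset ι) {F : ι → E d → ℂ} {ω : ι → Fin d → ℝ}
    (hF : ∀ i, Band (ω i) (F i)) :
    Band (fun j => ∑ i ∈ s, ω i j) fun x => ∏ i ∈ s, F i x := by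
  classical
  induction s using Finset.induction_on with
  | empty => simpa using one
  | insert i s hi ih =>
    simp_rw [Finset.prod_insert hi, Finset.sum_insert hi]
    exact (hF i).mul ih

lemma pow (hf : Band η f) (n : ℕ) : Band (fun j => n * η j) fun x => f x ^ n := by
  have := prod (Finset.range n) (F := fun _ => f) (ω := fun _ => η) fun _ => hf
  simpa using this

open Filter Topology in
/-- An integrable superposition of characters with frequencies in a box has a Fourier transform
which vanishes outside of this box. -/
theorem fourier_eq_zero {f : E d → ℝ} (hf : Integrable f) (hb : Band η fun x => (f x : ℂ))
    {ξ : E d} {j : Fin d} (hξ : η j < |ξ j|) : fourier f ξ = 0 := by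
  obtain ⟨Θ, _, μ, hμ, v, c, hv, hc, ⟨C, hC⟩, hη, hfx⟩ := hb
  set g : E d → ℂ := fun x => Complex.exp (-(Complex.I * (inner ℝ ξ x : ℝ))) * (f x : ℂ) with hg
  have hgi : Integrable g := by
    refine hf.ofReal.bdd_mul (c := 1) (by fun_prop : Continuous _).aestronglyMeasurable
      (Filter.Eventually.of_forall fun x => ?_)
    rw [← mul_neg, ← Complex.ofReal_neg, norm_exp_I_mul]
  have hlim := Real.tendsto_integral_cexp_sq_smul hgi
  set δ : ℝ := |ξ j| - η j with hδ
  have hδ0 : 0 < δ := sub_pos.2 hξ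
  -- All frequencies `v θ` stay at distance at least `δ` from `ξ`, as the `j`-th coordinate already
  -- shows.
  have hdist : ∀ θ, δ ≤ ‖v θ - ξ‖ := by
    intro θ
    have h1 : |(v θ - ξ) j| ≤ ‖v θ - ξ‖ := by
      simpa using PiLp.norm_apply_le (v θ - ξ) j
    have h2 : |ξ j| - |v θ j| ≤ |(v θ - ξ) j| := by
      rw [PiLp.sub_apply, abs_sub_comm]
      exact abs_sub_abs_le_abs_sub _ _
    have := hη θ j
    linarith
  -- With the weight `exp (-‖x‖² / b)`, Fubini leaves Gaussian transforms at `v θ - ξ`, each at most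
  -- `(π b)^{d/2} exp (-b δ² / 4)`. This tends to `0` as `b → ∞`, while the weighted integral tends
  -- to the transform of `f` at `ξ`.
  have hval : ∀ b : ℝ, 0 < b → ‖∫ x : E d, Complex.exp (-(b : ℂ)⁻¹ * ‖x‖ ^ 2) • g x‖
      ≤ (Real.pi ^ (d / 2 : ℝ) * C * μ.real Set.univ)
        * (b ^ (d / 2 : ℝ) * Real.exp (-(δ ^ 2 / 4) * b)) := by
    intro b hb
    have hbre : 0 < ((b : ℂ)⁻¹).re := by
      rw [← Complex.ofReal_inv, Complex.ofReal_re]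
      positivity
    have hGi := GaussianFourier.integrable_cexp_neg_mul_sq_norm_add (V := E d) hbre 0 0
    have hci : Integrable c μ := Integrable.of_bound hc.aestronglyMeasurable C
      (Filter.Eventually.of_forall hC)
    have hprod : Integrable (fun z : E d × Θ => Complex.exp (-(b : ℂ)⁻¹ * ‖z.1‖ ^ 2
        + Complex.I * (inner ℝ (v z.2 - ξ) z.1 : ℝ)) * c z.2) (volume.prod μ) := by
      have h1 := (hGi.mul_prod hci).bdd_mul
        (f := fun z : E d × Θ => Complex.exp (Complex.I * (inner ℝ (v z.2 - ξ) z.1 : ℝ))) (c := 1)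
        (by fun_prop : Measurable _).aestronglyMeasurable
        (Filter.Eventually.of_forall fun z => (norm_exp_I_mul _).le)
      refine h1.congr (Filter.Eventually.of_forall fun z => ?_)
      simp only [zero_mul, add_zero]
      rw [Complex.exp_add]
      ring
    have hswap := integral_integral_swap (f := fun x θ => Complex.exp (-(b : ℂ)⁻¹ * ‖x‖ ^ 2
        + Complex.I * (inner ℝ (v θ - ξ) x : ℝ)) * c θ) hprod
    have hL : ∀ x : E d, Complex.exp (-(b : ℂ)⁻¹ * ‖x‖ ^ 2) • g x
        = ∫ θ, Complex.exp (-(b : ℂ)⁻¹ * ‖x‖ ^ 2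
          + Complex.I * (inner ℝ (v θ - ξ) x : ℝ)) * c θ ∂μ := by
      intro x
      rw [hg]
      simp only [smul_eq_mul]
      rw [show (f x : ℂ) = _ from hfx x, ← mul_assoc, ← integral_const_mul]
      congr 1
      ext θ
      rw [← mul_assoc, ← Complex.exp_add, ← Complex.exp_add, inner_sub_left,
        real_inner_comm x (v θ)]
      congr 2
      push_cast
      ring
    simp_rw [hL]
    rw [hswap]
    have hbound : ∀ θ, ‖∫ x : E d, Complex.exp (-(b : ℂ)⁻¹ * ‖x‖ ^ 2
        + Complex.I * (inner ℝ (v θ - ξ) x : ℝ)) * c θ‖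
        ≤ Real.pi ^ (d / 2 : ℝ) * (b ^ (d / 2 : ℝ) * Real.exp (-(δ ^ 2 / 4) * b)) * C := by
      intro θ
      rw [integral_mul_const, norm_mul]
      refine mul_le_mul ?_ (hC θ) (norm_nonneg _) (by positivity)
      rw [GaussianFourier.integral_cexp_neg_mul_sq_norm_add hbre, norm_mul, ← mul_assoc,
        ← Real.mul_rpow (by positivity) hb.le]
      refine mul_le_mul ?_ ?_ (norm_nonneg _) (by positivity)
      · rw [div_inv_eq_mul, ← Complex.ofReal_mul, finrank_euclideanSpace_fin,
          Complex.norm_cpow_eq_rpow_re_of_pos (by positivity)]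
        simp
      · rw [Complex.norm_exp, Real.exp_le_exp]
        have e : Complex.I ^ 2 * ((‖v θ - ξ‖ : ℝ) : ℂ) ^ 2 / (4 * (b : ℂ)⁻¹)
            = ((-(‖v θ - ξ‖ ^ 2 / 4) * b : ℝ) : ℂ) := by
          have hb' : (b : ℂ) ≠ 0 := by exact_mod_cast hb.ne'
          push_cast
          rw [Complex.I_sq]
          field_simp
        rw [e, Complex.ofReal_re]
        have := hdist θ
        gcongr
    refine (norm_integral_le_of_norm_le_const (Filter.Eventually.of_forall hbound)).trans_eq ?_
    ring
  have hlim0 : Tendsto (fun b : ℝ => ∫ x : E d, Complex.exp (-(b : ℂ)⁻¹ * ‖x‖ ^ 2) • g x)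
      atTop (𝓝 0) := by
    have h1 := (tendsto_rpow_mul_exp_neg_mul_atTop_nhds_zero (d / 2 : ℝ) (δ ^ 2 / 4)
      (by positivity)).const_mul (Real.pi ^ (d / 2 : ℝ) * C * μ.real Set.univ)
    rw [mul_zero] at h1
    refine squeeze_zero_norm' ?_ h1
    filter_upwards [Filter.eventually_gt_atTop 0] with b hb using hval b hb
  have := tendsto_nhds_unique hlim0 (by simpa using hlim)
  exact this.symm

end Band

/-! ### Derivatives of the sinus cardinal and of its fourth power. -/

/-- The `k`-th derivative of the sinus cardinal `sin y / y`, as the integral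
`½ ∫_{-1}^1 t^k cos (y t + k π / 2) dt`. -/
noncomputable def sincDeriv (k : ℕ) (y : ℝ) : ℝ :=
  1 / 2 * ∫ t in (-1 : ℝ)..1, t ^ k * Real.cos (y * t + k * (Real.pi / 2))

lemma sincDeriv_zero (y : ℝ) : sincDeriv 0 y = Real.sinc y := by
  rcases eq_or_ne y 0 with rfl | hy
  · simp [sincDeriv]
    norm_num
  · simp [sincDeriv, Real.sinc_of_ne_zero hy, intervalIntegral.integral_comp_mul_left
      (fun t => Real.cos t) hy]
    field_simp
    ring

lemma sincDeriv_one_zero : sincDeriv 1 0 = 0 := by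
  simp [sincDeriv]

lemma sincDeriv_two_zero : sincDeriv 2 0 = -1 / 3 := by
  have : Real.cos (2 * (Real.pi / 2)) = -1 := by
    rw [mul_div_cancel₀ _ (two_ne_zero), Real.cos_pi]
  simp [sincDeriv, this]
  norm_num

lemma abs_pow_mul_cos_le (k : ℕ) {t : ℝ} (ht : t ∈ Set.uIoc (-1 : ℝ) 1) (a : ℝ) :
    ‖t ^ k * Real.cos a‖ ≤ 1 := by
  rw [Set.uIoc_of_le (by norm_num)] at ht
  have h1 : |t| ≤ 1 := abs_le.2 ⟨ht.1.le, ht.2⟩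
  rw [Real.norm_eq_abs, abs_mul, abs_pow]
  exact mul_le_one₀ (pow_le_one₀ (abs_nonneg t) h1) (abs_nonneg _) (Real.abs_cos_le_one a)

lemma abs_sincDeriv_le (k : ℕ) (y : ℝ) : |sincDeriv k y| ≤ 1 := by
  have h := intervalIntegral.norm_integral_le_of_norm_le_const (a := (-1 : ℝ)) (b := 1) (C := 1)
    (f := fun t => t ^ k * Real.cos (y * t + k * (Real.pi / 2)))
    fun t ht => abs_pow_mul_cos_le k ht _
  rw [Real.norm_eq_abs] at h
  rw [sincDeriv, abs_mul]
  norm_num at h ⊢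
  linarith

lemma hasDerivAt_sincDeriv (k : ℕ) (y : ℝ) :
    HasDerivAt (sincDeriv k) (sincDeriv (k + 1) y) y := by
  have key := (intervalIntegral.hasDerivAt_integral_of_dominated_loc_of_deriv_le (μ := volume)
    (a := (-1 : ℝ)) (b := 1) (s := Set.univ) (bound := fun _ => 1) (x₀ := y)
    (F := fun y t => t ^ k * Real.cos (y * t + k * (Real.pi / 2)))
    (F' := fun y t => t ^ (k + 1) * Real.cos (y * t + (k + 1 : ℕ) * (Real.pi / 2)))
    Filter.univ_mem
    (Filter.Eventually.of_forall fun y =>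
      (by fun_prop : Continuous fun t : ℝ => t ^ k * Real.cos (y * t + k * (Real.pi / 2))
        ).aestronglyMeasurable)
    ((by fun_prop : Continuous fun t : ℝ => t ^ k * Real.cos (y * t + k * (Real.pi / 2))
        ).intervalIntegrable _ _)
    (by fun_prop : Continuous fun t : ℝ => t ^ (k + 1) *
      Real.cos (y * t + (k + 1 : ℕ) * (Real.pi / 2))).aestronglyMeasurable
    (Filter.Eventually.of_forall fun t ht y _ => abs_pow_mul_cos_le _ ht _)
    intervalIntegrable_const
    (Filter.Eventually.of_forall fun t _ y _ => ?_)).2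
  · exact key.const_mul (1 / 2)
  · have h1 : HasDerivAt (fun y : ℝ => y * t + k * (Real.pi / 2)) t y := by
      simpa using ((hasDerivAt_id y).mul_const t).add_const (k * (Real.pi / 2))
    refine (h1.cos.const_mul (t ^ k)).congr_deriv ?_
    have : y * t + ((k + 1 : ℕ) : ℝ) * (Real.pi / 2)
        = (y * t + k * (Real.pi / 2)) + Real.pi / 2 := by push_cast; ring
    rw [this, Real.cos_add_pi_div_two]
    ring

lemma continuous_sincDeriv (k : ℕ) : Continuous (sincDeriv k) :=
  continuous_iff_continuousAt.2 fun y => (hasDerivAt_sincDeriv k y).continuousAt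

/-- The fourth power of the (normalized) sinus cardinal and its first two derivatives. -/
noncomputable def sincFour : ℕ → ℝ → ℝ
  | 0, y => sincDeriv 0 (y / 2) ^ 4
  | 1, y => 2 * sincDeriv 0 (y / 2) ^ 3 * sincDeriv 1 (y / 2)
  | _, y => 3 * sincDeriv 0 (y / 2) ^ 2 * sincDeriv 1 (y / 2) ^ 2
      + sincDeriv 0 (y / 2) ^ 3 * sincDeriv 2 (y / 2)

/-- The restriction `n ≤ 1` is essential: the last clause of `sincFour` returns the second
derivative for every index from `2` on. -/
lemma hasDerivAt_sincFour {n : ℕ} (hn : n ≤ 1) (y : ℝ) :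
    HasDerivAt (sincFour n) (sincFour (n + 1) y) y := by
  have h2 : HasDerivAt (fun y : ℝ => y / 2) (1 / 2) y := (hasDerivAt_id y).div_const 2
  have h : ∀ k, HasDerivAt (fun y => sincDeriv k (y / 2)) (sincDeriv (k + 1) (y / 2) * (1 / 2)) y :=
    fun k => HasDerivAt.comp (h₂ := sincDeriv k) y (hasDerivAt_sincDeriv k (y / 2)) h2
  interval_cases n
  · refine ((h 0).fun_pow 4).congr_deriv ?_
    simp only [sincFour]
    push_cast
    ring
  · refine ((((h 0).fun_pow 3).const_mul 2).fun_mul (h 1)).congr_deriv ?_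
    simp only [sincFour]
    push_cast
    ring

lemma continuous_sincFour (n : ℕ) : Continuous (sincFour n) := by
  have := continuous_sincDeriv
  match n with
  | 0 => unfold sincFour; fun_prop
  | 1 => unfold sincFour; fun_prop
  | n + 2 => unfold sincFour; fun_prop

lemma sincFour_zero_zero : sincFour 0 0 = 1 := by simp [sincFour, sincDeriv_zero]

lemma sincFour_one_zero : sincFour 1 0 = 0 := by simp [sincFour, sincDeriv_one_zero]

lemma sincFour_two_zero : sincFour 2 0 = -1 / 3 := by
  simp [sincFour, sincDeriv_one_zero, sincDeriv_zero, sincDeriv_two_zero]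

lemma sincDeriv_zero_sq_mul_le (y : ℝ) : sincDeriv 0 (y / 2) ^ 2 * y ^ 2 ≤ 4 := by
  rw [sincDeriv_zero, ← mul_pow]
  rcases eq_or_ne y 0 with rfl | hy
  · simp
  · rw [Real.sinc_of_ne_zero (by positivity)]
    have : Real.sin (y / 2) / (y / 2) * y = 2 * Real.sin (y / 2) := by field_simp
    rw [this]
    nlinarith [Real.sin_sq_le_one (y / 2)]

/-- Up to two derivatives of a fourth power still leave a factor `sinc²`, which provides the
quadratic decay used below; the cofactor is at most `3 + 1`. -/
lemma abs_sincFour_le_sq (n : ℕ) (y : ℝ) :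
    |sincFour n y| ≤ 4 * sincDeriv 0 (y / 2) ^ 2 := by
  have h0 := abs_sincDeriv_le 0 (y / 2)
  have h1 := abs_sincDeriv_le 1 (y / 2)
  have h2 := abs_sincDeriv_le 2 (y / 2)
  set a := sincDeriv 0 (y / 2)
  have hb : ∀ u : ℝ, |a ^ 2 * u| ≤ a ^ 2 * |u| := fun u => by rw [abs_mul, abs_of_nonneg (sq_nonneg a)]
  have ha : 0 ≤ a ^ 2 := sq_nonneg a
  rw [mul_comm]
  match n with
  | 0 =>
    simp only [sincFour]
    rw [show a ^ 4 = a ^ 2 * (a * a) by ring]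
    refine (hb _).trans (mul_le_mul_of_nonneg_left ?_ ha)
    rw [abs_mul]
    nlinarith [abs_nonneg a]
  | 1 =>
    simp only [sincFour]
    rw [show 2 * a ^ 3 * sincDeriv 1 (y / 2) = a ^ 2 * (2 * (a * sincDeriv 1 (y / 2))) by ring]
    refine (hb _).trans (mul_le_mul_of_nonneg_left ?_ ha)
    rw [abs_mul, abs_mul, abs_two]
    nlinarith [abs_nonneg a, abs_nonneg (sincDeriv 1 (y / 2))]
  | n + 2 =>
    simp only [sincFour]
    rw [show 3 * a ^ 2 * sincDeriv 1 (y / 2) ^ 2 + a ^ 3 * sincDeriv 2 (y / 2)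
      = a ^ 2 * (3 * sincDeriv 1 (y / 2) ^ 2 + a * sincDeriv 2 (y / 2)) by ring]
    refine (hb _).trans (mul_le_mul_of_nonneg_left ?_ ha)
    refine (abs_add_le _ _).trans ?_
    rw [abs_mul, abs_mul a, abs_pow]
    rw [abs_of_pos (by norm_num : (0 : ℝ) < 3)]
    nlinarith [abs_nonneg a, abs_nonneg (sincDeriv 1 (y / 2)), abs_nonneg (sincDeriv 2 (y / 2))]

lemma abs_sincFour_zero_le (y : ℝ) : |sincFour 0 y| ≤ 1 := by
  simp only [sincFour]
  rw [abs_pow]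
  exact pow_le_one₀ (abs_nonneg _) (abs_sincDeriv_le _ _)

lemma sincDeriv_sq_le_one (k : ℕ) (y : ℝ) : sincDeriv k y ^ 2 ≤ 1 := by
  rw [sq_le_one_iff_abs_le_one]
  exact abs_sincDeriv_le k y

/-- The form `4 ^ n` matters: undifferentiated factors contribute `1`, so products over coordinates
do not grow with the dimension. -/
lemma abs_sincFour_le_four_pow (n : ℕ) (y : ℝ) : |sincFour n y| ≤ 4 ^ n := by
  rcases Nat.eq_zero_or_pos n with rfl | hn
  · simpa using abs_sincFour_zero_le y
  · have h1 := abs_sincFour_le_sq n y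
    have h2 := sincDeriv_sq_le_one 0 (y / 2)
    have h3 : (4 : ℝ) ^ 1 ≤ 4 ^ n := pow_le_pow_right₀ (by norm_num) hn
    linarith

lemma abs_sincFour_mul_sq_le (n : ℕ) (y : ℝ) : |sincFour n y| * y ^ 2 ≤ 16 := by
  have h1 := mul_le_mul_of_nonneg_right (abs_sincFour_le_sq n y) (sq_nonneg y)
  have h2 := sincDeriv_zero_sq_mul_le y
  linarith

lemma abs_sincFour_le_inv (n : ℕ) (y : ℝ) : |sincFour n y| ≤ 20 * (1 + y ^ 2)⁻¹ := by
  rw [← div_eq_mul_inv, le_div_iff₀ (by positivity)]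
  have h1 := abs_sincFour_mul_sq_le n y
  have h2 := abs_sincFour_le_sq n y
  have h3 := sincDeriv_sq_le_one 0 (y / 2)
  linarith

/-- The partial derivative of order `e` of `∏_j sinc(u_j)^4`. -/
noncomputable def psiDeriv (e : Fin d → ℕ) (u : E d) : ℝ := ∏ j, sincFour (e j) (u j)

lemma continuous_psiDeriv (e : Fin d → ℕ) : Continuous (psiDeriv e) := by
  have := continuous_sincFour
  unfold psiDeriv
  fun_prop

lemma hasGradientAt_psiDeriv {e : Fin d → ℕ} (he : ∀ j, e j ≤ 1) (u : E d) :
    HasGradientAt (psiDeriv e) (WithLp.toLp 2 fun i => psiDeriv (e + Pi.single i 1) u) u := by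
  rw [hasGradientAt_iff_hasFDerivAt]
  have h1 : ∀ i ∈ Finset.univ, HasFDerivAt (fun u : E d => sincFour (e i) (u i))
      (sincFour (e i + 1) (u i) • (EuclideanSpace.proj i : E d →L[ℝ] ℝ)) u := fun i _ =>
    HasDerivAt.comp_hasFDerivAt (h₂ := sincFour (e i)) u (hasDerivAt_sincFour (he i) (u i))
      ((EuclideanSpace.proj i : E d →L[ℝ] ℝ).hasFDerivAt)
  have h2 := HasFDerivAt.finsetProd h1
  refine (h2.congr_of_eventuallyEq (Filter.Eventually.of_forall fun v => ?_)).congr_fderiv ?_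
  · rfl
  ext v
  simp only [InnerProductSpace.toDual_apply_apply, PiLp.inner_apply, sum_apply, smul_apply,
    smul_eq_mul, PiLp.proj_apply]
  refine Finset.sum_congr rfl fun i _ => ?_
  rw [psiDeriv, ← Finset.mul_prod_erase _ _ (Finset.mem_univ i)]
  have : ∏ j ∈ Finset.univ.erase i, sincFour ((e + Pi.single i 1 : Fin d → ℕ) j) (u j)
      = ∏ j ∈ Finset.univ.erase i, sincFour (e j) (u j) := by
    refine Finset.prod_congr rfl fun j hj => ?_
    simp [Pi.single_eq_of_ne (Finset.ne_of_mem_erase hj)]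
  rw [this]
  simp
  ring

/-- Split `‖u‖²` into its coordinates: the `i`-th factor absorbs `u i ^ 2` at cost `16`, and the
other factors multiply to at most `4 ^ 2`. Summing over `i` gives `256 * d`, linear in `d`. -/
lemma abs_psiDeriv_mul_norm_sq_le {e : Fin d → ℕ} (he : ∑ j, e j ≤ 2) (u : E d) :
    |psiDeriv e u| * ‖u‖ ^ 2 ≤ 256 * d := by
  have h1 : ∀ i, |psiDeriv e u| * u i ^ 2 ≤ 256 := by
    intro i
    rw [psiDeriv, ← Finset.mul_prod_erase _ _ (Finset.mem_univ i), abs_mul, Finset.abs_prod]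
    have h2 : ∏ j ∈ Finset.univ.erase i, |sincFour (e j) (u j)| ≤ 16 := by
      calc ∏ j ∈ Finset.univ.erase i, |sincFour (e j) (u j)|
          ≤ ∏ j ∈ Finset.univ.erase i, (4 : ℝ) ^ e j :=
            Finset.prod_le_prod (fun _ _ => abs_nonneg _) fun j _ => abs_sincFour_le_four_pow _ _
        _ = 4 ^ ∑ j ∈ Finset.univ.erase i, e j := Finset.prod_pow_eq_pow_sum _ _ _
        _ ≤ 4 ^ 2 := pow_le_pow_right₀ (by norm_num) (le_trans
            (Finset.sum_le_sum_of_subset (Finset.erase_subset _ _)) he)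
        _ = 16 := by norm_num
    have h3 := abs_sincFour_mul_sq_le (e i) (u i)
    calc _ = (|sincFour (e i) (u i)| * u i ^ 2)
          * ∏ j ∈ Finset.univ.erase i, |sincFour (e j) (u j)| := by ring
      _ ≤ 16 * 16 := by gcongr
      _ = 256 := by norm_num
  rw [EuclideanSpace.norm_sq_eq, Finset.mul_sum]
  refine (Finset.sum_le_sum fun i _ => by simpa using h1 i).trans_eq ?_
  simp
  ring

lemma abs_psiDeriv_le_prod (e : Fin d → ℕ) (u : E d) :
    |psiDeriv e u| ≤ ∏ j, 20 * (1 + u j ^ 2)⁻¹ := by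
  rw [psiDeriv, Finset.abs_prod]
  exact Finset.prod_le_prod (fun _ _ => abs_nonneg _) fun j _ => abs_sincFour_le_inv _ _

lemma psiM_eq (m : ℕ) (x : E d) : psiM m x = psiDeriv 0 ((m : ℝ) • x) := by
  simp [psiM, psi, psiDeriv, sincFour, sincDeriv_zero, Finset.prod_pow]

/-! ### Frequency boxes of the building blocks. -/

section band

lemma band_exp (j : Fin d) (a : ℝ) (k : ℕ) (z : ℂ) :
    Band (Pi.single j |a|) fun x : E d =>
      ∫ t in (-1 : ℝ)..1, Complex.exp (Complex.I * ((a * x j * t : ℝ) : ℂ)) * ((t : ℂ) ^ k * z) := by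
  have hfin : IsFiniteMeasure
      (Measure.comap (Subtype.val : Set.Icc (-1 : ℝ) 1 → ℝ) volume) := by
    refine ⟨?_⟩
    rw [comap_subtype_coe_apply measurableSet_Icc, Set.image_univ, Subtype.range_coe]
    simp
  have ht : ∀ t : Set.Icc (-1 : ℝ) 1, |(t : ℝ)| ≤ 1 := fun t => abs_le.2 t.2
  refine ⟨Set.Icc (-1 : ℝ) 1, _, Measure.comap Subtype.val volume, hfin, fun t => EuclideanSpace.single j (a * t),
    fun t => ((t : ℝ) : ℂ) ^ k * z, ?_, by fun_prop, ⟨‖z‖, fun t => ?_⟩, fun t i => ?_, fun x => ?_⟩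
  · have : ∀ t : Set.Icc (-1 : ℝ) 1, EuclideanSpace.single j (a * (t : ℝ))
        = (a * (t : ℝ)) • (EuclideanSpace.single j (1 : ℝ) : E d) := fun t => by
      ext i
      by_cases h : i = j
      · subst h; simp
      · simp [h]
    simp_rw [this]
    fun_prop
  · rw [norm_mul, norm_pow, Complex.norm_real]
    exact mul_le_of_le_one_left (norm_nonneg z) (pow_le_one₀ (norm_nonneg _) (ht t))
  · by_cases h : i = j
    · subst h
      simp only [PiLp.single_apply, if_true, Pi.single_eq_same, abs_mul]
      exact mul_le_of_le_one_right (abs_nonneg a) (ht t)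
    · simp [h]
  · beta_reduce
    rw [intervalIntegral.integral_of_le (by norm_num), ← integral_Icc_eq_integral_Ioc,
      ← integral_subtype_comap measurableSet_Icc]
    congr 1
    ext t
    rw [EuclideanSpace.inner_single_right]
    congr 3
    simp
    ring

/-- Each cosine in the integral representation splits into two exponentials, with opposite
frequencies and the phases `± k π / 2` moved into the amplitudes. -/
lemma band_sincDeriv (j : Fin d) {a : ℝ} (ha : 0 ≤ a) (k : ℕ) :
    Band (Pi.single j a) fun x : E d => (sincDeriv k (a * x j) : ℂ) := by
  have h1 := band_exp j a k (Complex.exp (Complex.I * ((k * (Real.pi / 2) : ℝ) : ℂ)) / 4)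
  have h2 := band_exp j (-a) k (Complex.exp (-(Complex.I * ((k * (Real.pi / 2) : ℝ) : ℂ))) / 4)
  rw [abs_neg] at h2
  rw [abs_of_nonneg ha] at h1 h2
  convert h1.add h2 using 2 with x
  rw [sincDeriv, ← intervalIntegral.integral_add]
  · push_cast
    rw [← intervalIntegral.integral_ofReal, ← intervalIntegral.integral_const_mul]
    congr 1
    ext t
    push_cast
    rw [Complex.cos]
    have e1 : ((a : ℂ) * (x j : ℂ) * t + k * (Real.pi / 2)) * Complex.I
      = Complex.I * (a * x j * t) + Complex.I * (k * (Real.pi / 2)) := by ring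
    have e2 : -((a : ℂ) * (x j : ℂ) * t + k * (Real.pi / 2)) * Complex.I
      = Complex.I * (-a * x j * t) + -(Complex.I * (k * (Real.pi / 2))) := by ring
    rw [e1, e2, Complex.exp_add, Complex.exp_add]
    ring
  · exact (by fun_prop : Continuous _).intervalIntegrable _ _
  · exact (by fun_prop : Continuous _).intervalIntegrable _ _

/-- Every term is a product of four factors of band `a / 2`, so all the derivatives share the band
`2 * a`. -/
lemma band_sincFour (j : Fin d) {a : ℝ} (ha : 0 ≤ a) (n : ℕ) :
    Band (Pi.single j (2 * a)) fun x : E d => (sincFour n (a * x j) : ℂ) := by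
  have h : ∀ k, Band (Pi.single j (a / 2)) fun x : E d => (sincDeriv k (a * x j / 2) : ℂ) := by
    intro k
    have := band_sincDeriv j (by positivity : 0 ≤ a / 2) k
    convert this using 4
    ring
  have hs : ∀ (c i : ℝ), (fun l => c * (Pi.single j i : Fin d → ℝ) l) = Pi.single j (c * i) := by
    intro c i
    ext l
    by_cases hl : l = j
    · subst hl; simp
    · simp [hl]
  have hle : ∀ (b c : ℝ), b = c → ∀ l,
      (Pi.single j b : Fin d → ℝ) l ≤ (Pi.single j c : Fin d → ℝ) l :=
    fun b c hbc l => by rw [hbc]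
  match n with
  | 0 =>
    have := (h 0).pow 4
    rw [hs] at this
    convert this.mono (hle _ (2 * a) (by push_cast; ring)) using 2 with x
    simp [sincFour]
  | 1 =>
    have h1 := (((h 0).pow 3).mul (h 1)).const_mul 2
    rw [show (fun l => ((3 : ℕ) : ℝ) * (Pi.single j (a / 2) : Fin d → ℝ) l
      + (Pi.single j (a / 2) : Fin d → ℝ) l)
      = fun l => 4 * (Pi.single j (a / 2) : Fin d → ℝ) l by ext l; push_cast; ring, hs] at h1
    convert h1.mono (hle _ (2 * a) (by ring)) using 2 with x
    simp [sincFour]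
    ring
  | n + 2 =>
    have h1 := (((h 0).pow 2).mul ((h 1).pow 2)).const_mul 3
    have h2 := ((h 0).pow 3).mul (h 2)
    rw [show (fun l => ((2 : ℕ) : ℝ) * (Pi.single j (a / 2) : Fin d → ℝ) l
      + ((2 : ℕ) : ℝ) * (Pi.single j (a / 2) : Fin d → ℝ) l)
      = fun l => 4 * (Pi.single j (a / 2) : Fin d → ℝ) l by ext l; push_cast; ring, hs] at h1
    rw [show (fun l => ((3 : ℕ) : ℝ) * (Pi.single j (a / 2) : Fin d → ℝ) l
      + (Pi.single j (a / 2) : Fin d → ℝ) l)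
      = fun l => 4 * (Pi.single j (a / 2) : Fin d → ℝ) l by ext l; push_cast; ring, hs] at h2
    convert (h1.add h2).mono (hle _ (2 * a) (by ring)) using 2 with x
    simp [sincFour]
    ring

lemma band_psiDeriv (e : Fin d → ℕ) {a : ℝ} (ha : 0 ≤ a) :
    Band (fun _ => 2 * a) fun x : E d => (psiDeriv e (a • x) : ℂ) := by
  have := Band.prod Finset.univ fun j => band_sincFour (d := d) j ha (e j)
  convert this using 2 with j x
  · simp [Finset.sum_pi_single]
  · simp [psiDeriv]

end band

/-! ### Gradient of the interpolating function and bounds on its coefficients. -/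

lemma HasGradientAt.comp_smul_sub {f : E d → ℝ} {g : E d} (m : ℝ) (x t : E d)
    (h : HasGradientAt f g (m • (x - t))) :
    HasGradientAt (fun x => f (m • (x - t))) (m • g) x := by
  rw [hasGradientAt_iff_hasFDerivAt] at h ⊢
  have h1 : HasFDerivAt (fun x : E d => m • (x - t)) (m • ContinuousLinearMap.id ℝ (E d)) x :=
    ((hasFDerivAt_id x).sub_const t).const_smul m
  refine (HasFDerivAt.comp (g := f) x h h1).congr_fderiv ?_
  ext v
  simp

/-- The gradient of `psiDeriv e`. -/
noncomputable def psiGrad (e : Fin d → ℕ) (u : E d) : E d :=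
  WithLp.toLp 2 fun i => psiDeriv (e + Pi.single i 1) u

lemma gradient_psiM (m : ℕ) (x : E d) :
    gradient (psiM m) x = (m : ℝ) • psiGrad 0 ((m : ℝ) • x) := by
  have h := HasGradientAt.comp_smul_sub (m : ℝ) x 0
    (hasGradientAt_psiDeriv (d := d) (e := 0) (by simp) _)
  simp only [sub_zero] at h
  rw [show psiM m = fun x : E d => psiDeriv 0 ((m : ℝ) • x) from funext (psiM_eq m)]
  exact h.gradient

lemma certRoot_eq (m : ℕ) (t : Fin K → E d) (α : Fin K → ℝ) (β : Fin K → E d) (x : E d) :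
    certRoot m t α β x = ∑ k, (α k * psiDeriv 0 ((m : ℝ) • (x - t k))
      + ∑ i, m * β k i * psiDeriv (Pi.single i 1) ((m : ℝ) • (x - t k))) := by
  rw [certRoot]
  refine Finset.sum_congr rfl fun k _ => ?_
  rw [psiM_eq, gradient_psiM, PiLp.inner_apply]
  congr 1
  refine Finset.sum_congr rfl fun i _ => ?_
  simp [psiGrad]
  ring

lemma hasGradientAt_certRoot (m : ℕ) (t : Fin K → E d) (α : Fin K → ℝ) (β : Fin K → E d)
    (x : E d) :
    HasGradientAt (certRoot m t α β) (∑ k, (α k • (m : ℝ) • psiGrad 0 ((m : ℝ) • (x - t k))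
      + ∑ i, (m * β k i) • (m : ℝ) • psiGrad (Pi.single i 1) ((m : ℝ) • (x - t k)))) x := by
  rw [show certRoot m t α β = _ from funext (certRoot_eq m t α β), hasGradientAt_iff_hasFDerivAt]
  have h : ∀ (e : Fin d → ℕ) (_ : ∀ j, e j ≤ 1) (k : Fin K), HasFDerivAt
      (fun x => psiDeriv e ((m : ℝ) • (x - t k)))
      (InnerProductSpace.toDual ℝ (E d) ((m : ℝ) • psiGrad e ((m : ℝ) • (x - t k)))) x :=
    fun e he k => (HasGradientAt.comp_smul_sub (m : ℝ) x (t k)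
      (hasGradientAt_psiDeriv he _)).hasFDerivAt
  have h1 : ∀ i j : Fin d, (Pi.single i 1 : Fin d → ℕ) j ≤ 1 := fun i j => by
    by_cases hij : j = i
    · subst hij; simp
    · simp [hij]
  refine (HasFDerivAt.fun_sum fun k _ => ((h 0 (by simp) k).const_mul (α k)).add
    (HasFDerivAt.fun_sum fun i _ => (h (Pi.single i 1) (h1 i) k).const_mul (m * β k i))
    ).congr_fderiv ?_
  simp only [map_sum, map_add, map_smul]

section dominance

/-- Diagonal dominance. With `S` the largest unknown in absolute value, the off-diagonal part of
each equation is at most `S / 8`; the diagonal entries `1` and `-1/3` give `S ≤ 1 + 3 S / 8`, hence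
`S ≤ 8 / 5`. -/
lemma abs_le_two_of_interpolation (a : Fin K → Fin K → ℝ) (b : Fin K → Fin K → Fin d → ℝ)
    (h : Fin K → Fin K → Fin d → Fin d → ℝ) (α : Fin K → ℝ) (γ : Fin K → Fin d → ℝ) {ε : ℝ}
    (hε : ε * (K * (1 + d)) ≤ 1 / 8) (hε0 : 0 ≤ ε)
    (ha : ∀ k l, l ≠ k → |a k l| ≤ ε) (hb : ∀ k l i, l ≠ k → |b k l i| ≤ ε)
    (hh : ∀ k l i j, l ≠ k → |h k l i j| ≤ ε)
    (h1 : ∀ k, α k + ∑ l ∈ Finset.univ.erase k, (α l * a k l + ∑ i, γ l i * b k l i) = 1)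
    (h2 : ∀ k j, γ k j * (-1 / 3)
      + ∑ l ∈ Finset.univ.erase k, (α l * b k l j + ∑ i, γ l i * h k l i j) = 0) :
    (∀ k, |α k| ≤ 2) ∧ ∀ k j, |γ k j| ≤ 2 := by
  set S := max ‖α‖ ‖γ‖ with hS
  have hS0 : 0 ≤ S := (norm_nonneg α).trans (le_max_left _ _)
  have hα : ∀ k, |α k| ≤ S := fun k => (norm_le_pi_norm α k).trans (le_max_left _ _)
  have hγ : ∀ k j, |γ k j| ≤ S := fun k j =>
    ((norm_le_pi_norm (γ k) j).trans (norm_le_pi_norm γ k)).trans (le_max_right _ _)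
  have key : ∀ (k : Fin K) (p : Fin K → ℝ) (q : Fin K → Fin d → ℝ),
      (∀ l, l ≠ k → |p l| ≤ ε) → (∀ l i, l ≠ k → |q l i| ≤ ε) →
      |∑ l ∈ Finset.univ.erase k, (α l * p l + ∑ i, γ l i * q l i)| ≤ S / 8 := by
    intro k p q hp hq
    calc |∑ l ∈ Finset.univ.erase k, (α l * p l + ∑ i, γ l i * q l i)|
        ≤ ∑ l ∈ Finset.univ.erase k, |α l * p l + ∑ i, γ l i * q l i| :=
          Finset.abs_sum_le_sum_abs _ _
      _ ≤ ∑ l ∈ Finset.univ.erase k, S * ε * (1 + d) := by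
          refine Finset.sum_le_sum fun l hl => ?_
          have hlk := Finset.ne_of_mem_erase hl
          have e1 : |α l * p l| ≤ S * ε := by
            rw [abs_mul]
            exact mul_le_mul (hα l) (hp l hlk) (abs_nonneg _) hS0
          have e2 : |∑ i, γ l i * q l i| ≤ ∑ _i : Fin d, S * ε := by
            refine (Finset.abs_sum_le_sum_abs _ _).trans (Finset.sum_le_sum fun i _ => ?_)
            rw [abs_mul]
            exact mul_le_mul (hγ l i) (hq l i hlk) (abs_nonneg _) hS0
          rw [Finset.sum_const, Finset.card_univ, Fintype.card_fin, nsmul_eq_mul] at e2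
          have := abs_add_le (α l * p l) (∑ i, γ l i * q l i)
          linarith
      _ ≤ ∑ _l : Fin K, S * ε * (1 + d) :=
          Finset.sum_le_sum_of_subset_of_nonneg (Finset.erase_subset _ _)
            fun _ _ _ => by positivity
      _ = S * (ε * (K * (1 + d))) := by
          rw [Finset.sum_const, Finset.card_univ, Fintype.card_fin, nsmul_eq_mul]
          ring
      _ ≤ S * (1 / 8) := by gcongr
      _ = S / 8 := by ring
  have hα' : ∀ k, |α k| ≤ 1 + S / 8 := by
    intro k
    have e := key k (a k) (b k) (ha k) (hb k)
    have e' := h1 k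
    rw [abs_le] at e ⊢
    constructor <;> linarith [e.1, e.2]
  have hγ' : ∀ k j, |γ k j| ≤ 1 + 3 * S / 8 := by
    intro k j
    have e := key k (fun l => b k l j) (fun l i => h k l i j) (fun l hl => hb k l j hl)
      (fun l i hl => hh k l i j hl)
    have e' := h2 k j
    rw [abs_le] at e ⊢
    constructor <;> linarith [e.1, e.2]
  have hSle : S ≤ 1 + 3 * S / 8 := by
    refine max_le ?_ ?_
    · rw [pi_norm_le_iff_of_nonneg (by positivity)]
      intro k
      exact (hα' k).trans (by linarith)
    · rw [pi_norm_le_iff_of_nonneg (by positivity)]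
      intro k
      rw [pi_norm_le_iff_of_nonneg (by positivity)]
      exact hγ' k
  exact ⟨fun k => (hα k).trans (by linarith), fun k j => (hγ k j).trans (by linarith)⟩

end dominance

lemma psiDeriv_zero_zero : psiDeriv (0 : Fin d → ℕ) 0 = 1 := by
  simp [psiDeriv, sincFour_zero_zero]

lemma psiDeriv_single_zero (i : Fin d) : psiDeriv (Pi.single i 1) (0 : E d) = 0 := by
  rw [psiDeriv, Finset.prod_eq_zero (Finset.mem_univ i)]
  simp [sincFour_one_zero]

lemma psiDeriv_single_add_single_zero (i j : Fin d) :
    psiDeriv (Pi.single i 1 + Pi.single j 1) (0 : E d) = if i = j then -1 / 3 else 0 := by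
  rw [psiDeriv]
  split_ifs with h
  · subst h
    rw [Finset.prod_eq_single i]
    · simp [sincFour_two_zero]
    · intro l _ hl
      simp [hl, sincFour_zero_zero]
    · simp
  · refine Finset.prod_eq_zero (Finset.mem_univ i) ?_
    simp [h, sincFour_one_zero]

lemma sepPlus_pos (t : Fin K → E d) (ht : Function.Injective t) : 0 < sepPlus t := by
  have hfin : (insert 1 {r : ℝ | ∃ k l, k ≠ l ∧ r = ‖t k - t l‖}).Finite := by
    refine Set.Finite.insert _ ((Set.finite_range fun p : Fin K × Fin K => ‖t p.1 - t p.2‖).subset ?_)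
    rintro r ⟨k, l, -, rfl⟩
    exact ⟨(k, l), rfl⟩
  have hmem := Set.Nonempty.csInf_mem (Set.insert_nonempty _ _) hfin
  rw [sepPlus]
  rcases hmem with h | ⟨k, l, hkl, h⟩
  · rw [h]; exact one_pos
  · rw [h, norm_pos_iff, sub_ne_zero]
    exact fun he => hkl (ht he)

lemma sepPlus_le (t : Fin K → E d) {k l : Fin K} (hkl : k ≠ l) : sepPlus t ≤ ‖t k - t l‖ := by
  refine csInf_le ⟨0, ?_⟩ (Or.inr ⟨k, l, hkl, rfl⟩)
  rintro r (rfl | ⟨k, l, -, rfl⟩)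
  · exact zero_le_one
  · exact norm_nonneg _

/-- The coefficients of the interpolating function are bounded by an absolute constant. -/
theorem coeff_le_two (hd : 0 < d) (hK : 0 < K) {t : Fin K → E d} (ht : Function.Injective t)
    {m : ℕ} (hm0 : 0 < m) (hm : 64 * Real.sqrt K * (d : ℝ) ^ (3 / 2 : ℝ) / sepPlus t ≤ m)
    {α : Fin K → ℝ} {β : Fin K → E d} (hI : Interpolates m t α β) :
    (∀ k, |α k| ≤ 2) ∧ ∀ k j, |m * β k j| ≤ 2 := by
  have hd' : (1 : ℝ) ≤ d := by exact_mod_cast hd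
  have hK' : (0 : ℝ) < K := by exact_mod_cast hK
  have hm' : (0 : ℝ) < m := by exact_mod_cast hm0
  -- Separation gives `‖m (t_k - t_l)‖² ≥ 64² K d³`, so the bound `256 d / ‖u‖²` becomes `1 / (16 K
  -- d²)`. Its product with the row length `K (1 + d)` is at most `1 / 8`.
  have hfar : ∀ k l, l ≠ k → ∀ e : Fin d → ℕ, ∑ j, e j ≤ 2 →
      |psiDeriv e ((m : ℝ) • (t k - t l))| ≤ 1 / (16 * K * d ^ 2) := by
    intro k l hkl e he
    have h1 := abs_psiDeriv_mul_norm_sq_le he ((m : ℝ) • (t k - t l))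
    rw [div_le_iff₀ (sepPlus_pos t ht)] at hm
    have h2 : 64 * Real.sqrt K * (d : ℝ) ^ (3 / 2 : ℝ) ≤ ‖(m : ℝ) • (t k - t l)‖ := by
      rw [norm_smul, Real.norm_of_nonneg hm'.le]
      exact hm.trans (mul_le_mul_of_nonneg_left (sepPlus_le t hkl.symm) hm'.le)
    have h3 : 4096 * K * (d : ℝ) ^ 3 ≤ ‖(m : ℝ) • (t k - t l)‖ ^ 2 := by
      refine le_trans (le_of_eq ?_) (pow_le_pow_left₀ (by positivity) h2 2)
      rw [mul_pow, mul_pow, Real.sq_sqrt hK'.le, ← Real.rpow_natCast ((d : ℝ) ^ (3 / 2 : ℝ)),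
        ← Real.rpow_mul (by positivity), ← Real.rpow_natCast (d : ℝ) 3]
      norm_num
    have h4 := (mul_le_mul_of_nonneg_left h3 (abs_nonneg _)).trans h1
    rw [le_div_iff₀ (by positivity)]
    have hdp : (0 : ℝ) < 256 * d := by positivity
    refine le_of_mul_le_mul_right ?_ hdp
    calc _ = |psiDeriv e ((m : ℝ) • (t k - t l))| * (4096 * K * (d : ℝ) ^ 3) := by ring
      _ ≤ _ := h4
      _ = _ := by ring
  have hs : ∀ i : Fin d, ∑ j, (Pi.single i 1 : Fin d → ℕ) j = 1 := fun i => by simp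
  refine abs_le_two_of_interpolation
    (a := fun k l => psiDeriv 0 ((m : ℝ) • (t k - t l)))
    (b := fun k l i => psiDeriv (Pi.single i 1) ((m : ℝ) • (t k - t l)))
    (h := fun k l i j => psiDeriv (Pi.single i 1 + Pi.single j 1) ((m : ℝ) • (t k - t l)))
    (α := α) (γ := fun k i => m * β k i) (ε := 1 / (16 * K * d ^ 2)) ?_ (by positivity)
    (fun k l hkl => hfar k l hkl _ (by simp))
    (fun k l i hkl => hfar k l hkl _ (by rw [hs]; norm_num))
    (fun k l i j hkl => hfar k l hkl _ (by
      simp only [Pi.add_apply, Finset.sum_add_distrib, hs]; norm_num)) ?_ ?_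
  · rw [div_mul_eq_mul_div, div_le_div_iff₀ (by positivity) (by positivity)]
    have : K * (d : ℝ) ≤ K * d ^ 2 := by gcongr; nlinarith
    have : K * (1 : ℝ) ≤ K * d ^ 2 := by gcongr; nlinarith
    nlinarith
  · intro k
    have h1 := (hI k).1
    rw [certRoot_eq, ← Finset.add_sum_erase _ _ (Finset.mem_univ k)] at h1
    simpa [psiDeriv_zero_zero, psiDeriv_single_zero] using h1
  · intro k j
    have h1 := (hI k).2
    rw [(hasGradientAt_certRoot m t α β (t k)).gradient] at h1
    -- Dividing by the factor `m` of the chain rule makes the system scale free in the unknowns `α`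
    -- and `m β`.
    have h2 := congrArg (fun v : E d => (m : ℝ)⁻¹ * v j) h1
    simp only [PiLp.zero_apply, mul_zero, WithLp.ofLp_sum, Finset.sum_apply, PiLp.add_apply,
      PiLp.smul_apply, smul_eq_mul, psiGrad, Finset.mul_sum, mul_add, zero_add] at h2
    have e1 : ∀ c p : ℝ, (m : ℝ)⁻¹ * (c * (m * p)) = c * p := fun c p => by field_simp
    simp only [e1] at h2
    rw [← Finset.add_sum_erase _ _ (Finset.mem_univ k)] at h2
    simp only [sub_self, smul_zero, psiDeriv_single_zero, psiDeriv_single_add_single_zero,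
      mul_ite, mul_zero, Finset.sum_ite_eq', Finset.mem_univ, if_true, zero_add] at h2
    exact h2

/-! ### Decay, spectrum and `L²` norm of the certificate. -/

section decay

/-- The function `∏_j 20 / (1 + u_j²)`, which dominates `psiDeriv e`. -/
noncomputable def decay (u : E d) : ℝ := ∏ j, 20 * (1 + u j ^ 2)⁻¹

lemma decay_nonneg (u : E d) : 0 ≤ decay u := Finset.prod_nonneg fun j _ => by positivity

lemma decay_le (u : E d) : decay u ≤ 20 ^ d := by
  calc decay u ≤ ∏ _j : Fin d, (20 : ℝ) := by
        refine Finset.prod_le_prod (fun j _ => by positivity) fun j _ => ?_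
        have : (1 + u j ^ 2)⁻¹ ≤ 1 := inv_le_one_of_one_le₀ (by nlinarith [sq_nonneg (u j)])
        linarith
    _ = 20 ^ d := by simp

lemma integrable_decay : Integrable (decay : E d → ℝ) := by
  have h1 : Integrable fun u : Fin d → ℝ => ∏ j, 20 * (1 + u j ^ 2)⁻¹ :=
    Integrable.fintype_prod (f := fun _ y => 20 * (1 + y ^ 2)⁻¹)
      fun _ => integrable_inv_one_add_sq.const_mul 20
  exact (PiLp.volume_preserving_ofLp (Fin d)).integrable_comp_of_integrable h1

lemma _root_.MeasureTheory.Integrable.pow_succ_of_bounded {f : E d → ℝ} (hf : Integrable f) {M : ℝ}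
    (hM : ∀ x, |f x| ≤ M) (n : ℕ) : Integrable fun x => f x ^ (n + 1) := by
  simp_rw [pow_succ]
  exact hf.bdd_mul (hf.aestronglyMeasurable.pow n) (c := M ^ n)
    (Filter.Eventually.of_forall fun x => by
      rw [Real.norm_eq_abs, abs_pow]
      exact pow_le_pow_left₀ (abs_nonneg _) (hM x) n)

lemma integrable_decay_pow (n : ℕ) : Integrable fun u : E d => decay u ^ (n + 1) :=
  integrable_decay.pow_succ_of_bounded
    (fun u => (abs_of_nonneg (decay_nonneg u)).trans_le (decay_le u)) n

lemma integral_comp_smul_sub (f : E d → ℝ) {a : ℝ} (ha : 0 < a) (t : E d) :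
    ∫ x, f (a • (x - t)) = (a ^ d)⁻¹ * ∫ x, f x := by
  rw [integral_sub_right_eq_self (fun x => f (a • x)) t, Measure.integral_comp_smul,
    finrank_euclideanSpace_fin, abs_of_nonneg (by positivity), smul_eq_mul]

lemma integrable_comp_smul_sub {f : E d → ℝ} (hf : Integrable f) {a : ℝ} (ha : 0 < a) (t : E d) :
    Integrable fun x => f (a • (x - t)) :=
  (hf.comp_smul ha.ne').comp_sub_right t

end decay

section cert

variable {m : ℕ} {t : Fin K → E d} {α : Fin K → ℝ} {β : Fin K → E d}

lemma continuous_certRoot (m : ℕ) (t : Fin K → E d) (α : Fin K → ℝ) (β : Fin K → E d) :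
    Continuous (certRoot m t α β) := by
  rw [show certRoot m t α β = _ from funext (certRoot_eq m t α β)]
  have := continuous_psiDeriv (d := d)
  fun_prop

lemma continuous_cert (m : ℕ) (t : Fin K → E d) (α : Fin K → ℝ) (β : Fin K → E d) :
    Continuous (cert m t α β) := (continuous_certRoot m t α β).pow 2

lemma band_certRoot (m : ℕ) (t : Fin K → E d) (α : Fin K → ℝ) (β : Fin K → E d) :
    Band (fun _ => 2 * (m : ℝ)) fun x => (certRoot m t α β x : ℂ) := by
  have h : ∀ e k, Band (fun _ => 2 * (m : ℝ)) fun x => (psiDeriv e ((m : ℝ) • (x - t k)) : ℂ) :=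
    fun e k => (band_psiDeriv (d := d) e (Nat.cast_nonneg m)).translate (t k)
  have h0 : ∀ _ : Fin d, (0 : ℝ) ≤ 2 * m := fun _ => by positivity
  have h1 := Band.sum h0 Finset.univ fun k => ((h 0 k).const_mul (α k)).add
    (Band.sum h0 Finset.univ fun i => (h (Pi.single i 1) k).const_mul (m * β k i : ℝ))
  convert h1 using 2 with x
  rw [certRoot_eq]
  push_cast
  rfl

lemma band_cert (m : ℕ) (t : Fin K → E d) (α : Fin K → ℝ) (β : Fin K → E d) :
    Band (fun _ => 4 * (m : ℝ)) fun x => (cert m t α β x : ℂ) := by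
  have h := ((band_certRoot m t α β).mul (band_certRoot m t α β)).mono
    (η' := fun _ => 4 * (m : ℝ)) fun j => by linarith
  convert h using 2 with x
  rw [cert]
  push_cast
  ring

lemma abs_certRoot_le (hα : ∀ k, |α k| ≤ 2) (hβ : ∀ k j, |m * β k j| ≤ 2) (x : E d) :
    |certRoot m t α β x| ≤ 2 * (1 + d) * ∑ k, decay ((m : ℝ) • (x - t k)) := by
  rw [certRoot_eq, Finset.mul_sum]
  refine (Finset.abs_sum_le_sum_abs _ _).trans (Finset.sum_le_sum fun k _ => ?_)
  set u := (m : ℝ) • (x - t k)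
  have h1 : |α k * psiDeriv 0 u| ≤ 2 * decay u := by
    rw [abs_mul]
    exact mul_le_mul (hα k) (abs_psiDeriv_le_prod _ u) (abs_nonneg _) zero_le_two
  have h2 : |∑ i, m * β k i * psiDeriv (Pi.single i 1) u| ≤ ∑ _i : Fin d, 2 * decay u := by
    refine (Finset.abs_sum_le_sum_abs _ _).trans (Finset.sum_le_sum fun i _ => ?_)
    rw [abs_mul]
    exact mul_le_mul (hβ k i) (abs_psiDeriv_le_prod _ u) (abs_nonneg _) zero_le_two
  rw [Finset.sum_const, Finset.card_univ, Fintype.card_fin, nsmul_eq_mul] at h2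
  refine (abs_add_le _ _).trans ?_
  linarith

lemma abs_certRoot_le_const (hα : ∀ k, |α k| ≤ 2) (hβ : ∀ k j, |m * β k j| ≤ 2) (x : E d) :
    |certRoot m t α β x| ≤ 2 * (1 + d) * (K * 20 ^ d) := by
  refine (abs_certRoot_le hα hβ x).trans ?_
  gcongr
  refine (Finset.sum_le_sum fun k _ => decay_le _).trans (le_of_eq ?_)
  simp

lemma integrable_certRoot (hm : 0 < m) (hα : ∀ k, |α k| ≤ 2) (hβ : ∀ k j, |m * β k j| ≤ 2) :
    Integrable (certRoot m t α β) := by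
  have hm' : (0 : ℝ) < m := by exact_mod_cast hm
  refine Integrable.mono' ((integrable_finsetSum Finset.univ fun k _ =>
    integrable_comp_smul_sub integrable_decay hm' (t k)).const_mul (2 * (1 + d : ℝ)))
    (continuous_certRoot m t α β).aestronglyMeasurable
    (Filter.Eventually.of_forall fun x => abs_certRoot_le hα hβ x)

lemma integrable_cert (hm : 0 < m) (hα : ∀ k, |α k| ≤ 2) (hβ : ∀ k j, |m * β k j| ≤ 2) :
    Integrable (cert m t α β) :=
  (integrable_certRoot hm hα hβ).pow_succ_of_bounded (abs_certRoot_le_const hα hβ) 1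

lemma abs_cert_le (hα : ∀ k, |α k| ≤ 2) (hβ : ∀ k j, |m * β k j| ≤ 2) (x : E d) :
    ‖cert m t α β x‖ ≤ (2 * (1 + d) * (K * 20 ^ d)) ^ 2 := by
  rw [cert, norm_pow]
  exact pow_le_pow_left₀ (norm_nonneg _) (abs_certRoot_le_const hα hβ x) 2

lemma integrable_cert_sq (hm : 0 < m) (hα : ∀ k, |α k| ≤ 2) (hβ : ∀ k j, |m * β k j| ≤ 2) :
    Integrable fun x => cert m t α β x ^ 2 :=
  (integrable_cert hm hα hβ).pow_succ_of_bounded (abs_cert_le hα hβ) 1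

lemma fourier_cert_eq_zero (hm : 0 < m) (hα : ∀ k, |α k| ≤ 2) (hβ : ∀ k j, |m * β k j| ≤ 2)
    {ξ : E d} (hξ : ξ ∉ cube d (4 * m)) : fourier (cert m t α β) ξ = 0 := by
  simp only [cube, Set.mem_ofPred_eq, not_forall, not_le] at hξ
  obtain ⟨j, hj⟩ := hξ
  exact Band.fourier_eq_zero (integrable_cert hm hα hβ) (band_cert m t α β) hj

/-- The bound `‖P_m‖₂² ≤ C_d K⁴ m^{-d}`. -/
lemma integral_cert_sq_le (hm : 0 < m) (hα : ∀ k, |α k| ≤ 2) (hβ : ∀ k j, |m * β k j| ≤ 2) :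
    ∫ x, cert m t α β x ^ 2
      ≤ (2 * (1 + d)) ^ 4 * (∫ u : E d, decay u ^ 4) * ((K : ℝ) ^ 4 * ((m : ℝ) ^ d)⁻¹) := by
  have hm' : (0 : ℝ) < m := by exact_mod_cast hm
  have hi : ∀ k, Integrable fun x => decay ((m : ℝ) • (x - t k)) ^ 4 := fun k =>
    integrable_comp_smul_sub (integrable_decay_pow 3) hm' (t k)
  have hpt : ∀ x, cert m t α β x ^ 2
      ≤ (2 * (1 + d)) ^ 4 * (K : ℝ) ^ 3 * ∑ k, decay ((m : ℝ) • (x - t k)) ^ 4 := by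
    intro x
    -- The power-mean inequality costs `K³`; the `K` equal integrals supply the fourth power of `K`,
    -- and the dilation supplies `m^{-d}`.
    have h1 : (∑ k, decay ((m : ℝ) • (x - t k))) ^ 4
        ≤ (K : ℝ) ^ 3 * ∑ k, decay ((m : ℝ) • (x - t k)) ^ 4 := by
      simpa using pow_sum_le_card_mul_sum_pow (s := Finset.univ)
        (f := fun k => decay ((m : ℝ) • (x - t k))) (fun k _ => decay_nonneg _) 3
    rw [cert, ← pow_mul, ← (by decide : Even (2 * 2)).pow_abs]
    refine (pow_le_pow_left₀ (abs_nonneg _) (abs_certRoot_le hα hβ x) _).trans ?_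
    rw [mul_pow, mul_assoc]
    gcongr
  refine (integral_mono (integrable_cert_sq hm hα hβ)
    ((integrable_finsetSum Finset.univ fun k _ => hi k).const_mul _) hpt).trans (le_of_eq ?_)
  rw [integral_const_mul, integral_finsetSum _ fun k _ => hi k]
  simp_rw [fun k => integral_comp_smul_sub (fun u : E d => decay u ^ 4) hm' (t k)]
  rw [Finset.sum_const, Finset.card_univ, Fintype.card_fin, nsmul_eq_mul]
  ring

end cert

/-! ### Membership in the RKHS through the spectral form of its norm. -/

section RKHS

variable {H : Type*} [NormedAddCommGroup H] [InnerProductSpace ℝ H] [CompleteSpace H]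
  [RKHS ℝ H (E d) ℝ]

/-- A function `g` belongs to the reproducing kernel Hilbert space, with norm at most `M`, as soon
as the linear form `∑ a_i kerAt x_i ↦ ∑ a_i g(x_i)` has norm at most `M`. -/
lemma exists_RKHS_of_forall_abs_le {g : E d → ℝ} {M : ℝ} (hM : 0 ≤ M)
    (hg : ∀ a : E d →₀ ℝ,
      |a.sum fun x r => r * g x| ≤ M * ‖a.sum fun x r => r • kerAt H x‖) :
    ∃ c : H, ‖c‖ ≤ M ∧ ∀ x, c x = g x := by
  let A : (E d →₀ ℝ) →ₗ[ℝ] H := Finsupp.linearCombination ℝ (kerAt H)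
  let l : (E d →₀ ℝ) →ₗ[ℝ] ℝ := Finsupp.linearCombination ℝ g
  have hl : ∀ a, |l a| ≤ M * ‖A a‖ := fun a => by
    simpa [A, l, Finsupp.linearCombination_apply] using hg a
  -- The bound forces `l` to vanish on `ker A`, so `l` descends to the span of the kernel functions.
  -- Hahn–Banach extends it with the same norm and Riesz represents it.
  have hker : A.ker ≤ l.ker := fun a ha => by
    have := hl a
    rw [LinearMap.mem_ker.1 ha, norm_zero, mul_zero] at this
    exact LinearMap.mem_ker.2 (abs_nonpos_iff.1 this)
  let f : A.range →ₗ[ℝ] ℝ := (A.ker.liftQ l hker).comp A.quotKerEquivRange.symm.toLinearMap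
  have hf : ∀ a, f ⟨A a, LinearMap.mem_range_self A a⟩ = l a := fun a => by
    simp only [f, LinearMap.comp_apply, LinearEquiv.coe_coe]
    rw [LinearMap.quotKerEquivRange_symm_apply_image]
    simp
  have hfb : ∀ v, ‖f v‖ ≤ M * ‖v‖ := by
    rintro ⟨_, a, rfl⟩
    rw [hf]
    exact hl a
  obtain ⟨F, hF, hFn⟩ := exists_extension_norm_eq _ (f.mkContinuous M hfb)
  refine ⟨(InnerProductSpace.toDual ℝ H).symm F, ?_, fun x => ?_⟩
  · rw [LinearIsometryEquiv.norm_map, hFn]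
    exact f.mkContinuous_norm_le hM hfb
  · rw [← inner_kerAt, InnerProductSpace.toDual_symm_apply]
    have h1 : A (Finsupp.single x 1) = kerAt H x := by simp [A]
    have h2 := hF ⟨A (Finsupp.single x 1), LinearMap.mem_range_self A _⟩
    rw [LinearMap.mkContinuous_apply, hf] at h2
    rw [← h1]
    refine h2.trans ?_
    simp [l]

/-- The trigonometric polynomial `∑_x a_x e^{i x·ξ}`. -/
noncomputable def trigPoly (a : E d →₀ ℝ) (ξ : E d) : ℂ :=
  a.sum fun x r => r * Complex.exp (Complex.I * (inner ℝ x ξ : ℝ))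

lemma continuous_trigPoly (a : E d →₀ ℝ) : Continuous (trigPoly a) := by
  unfold trigPoly Finsupp.sum
  fun_prop

lemma norm_trigPoly_le (a : E d →₀ ℝ) (ξ : E d) : ‖trigPoly a ξ‖ ≤ ∑ x ∈ a.support, ‖a x‖ := by
  refine (norm_sum_le _ _).trans (Finset.sum_le_sum fun x _ => ?_)
  rw [norm_mul, norm_exp_I_mul, mul_one, Complex.norm_real]

variable {φ lam s : E d → ℝ}

lemma integrable_norm_trigPoly_sq_mul (hs : IsFourierTransformOf lam s) (a : E d →₀ ℝ) :
    Integrable fun ξ => ‖trigPoly a ξ‖ ^ 2 * s ξ := by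
  refine hs.integrable.bdd_mul (c := (∑ x ∈ a.support, ‖a x‖) ^ 2)
    ((continuous_trigPoly a).norm.pow 2).aestronglyMeasurable
    (Filter.Eventually.of_forall fun ξ => ?_)
  rw [norm_pow, norm_norm]
  exact pow_le_pow_left₀ (norm_nonneg _) (norm_trigPoly_le a ξ) 2

/-- The spectral representation of the norm of the reproducing kernel Hilbert space. -/
lemma integral_norm_trigPoly_sq_mul (h : HasKernel H lam) (hs : IsFourierTransformOf lam s)
    (a : E d →₀ ℝ) :
    ∫ ξ, ‖trigPoly a ξ‖ ^ 2 * s ξ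
      = (2 * Real.pi) ^ d * ‖a.sum fun x r => r • kerAt H x‖ ^ 2 := by
  have hint : ∀ x y, Integrable fun ξ => (a x * a y : ℂ) *
      (Complex.exp (Complex.I * (inner ℝ (x - y) ξ : ℝ)) * (s ξ : ℂ)) := fun x y => by
    refine Integrable.const_mul (hs.integrable.ofReal.bdd_mul (c := 1)
      (by fun_prop : Continuous _).aestronglyMeasurable
      (Filter.Eventually.of_forall fun ξ => (norm_exp_I_mul _).le)) _
  have hpt : ∀ ξ, ((‖trigPoly a ξ‖ ^ 2 * s ξ : ℝ) : ℂ)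
      = ∑ x ∈ a.support, ∑ y ∈ a.support, (a x * a y : ℂ) *
        (Complex.exp (Complex.I * (inner ℝ (x - y) ξ : ℝ)) * (s ξ : ℂ)) := by
    intro ξ
    push_cast
    rw [← Complex.mul_conj', trigPoly, Finsupp.sum, map_sum, Finset.sum_mul_sum, Finset.sum_mul]
    refine Finset.sum_congr rfl fun x _ => ?_
    rw [Finset.sum_mul]
    refine Finset.sum_congr rfl fun y _ => ?_
    rw [map_mul, Complex.conj_ofReal, ← Complex.exp_conj, map_mul, Complex.conj_I,
      Complex.conj_ofReal]
    have : Complex.exp (Complex.I * (inner ℝ (x - y) ξ : ℝ))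
        = Complex.exp (Complex.I * (inner ℝ x ξ : ℝ))
          * Complex.exp (-Complex.I * (inner ℝ y ξ : ℝ)) := by
      rw [← Complex.exp_add, inner_sub_left]
      congr 1
      push_cast
      ring
    rw [this]
    ring
  have hn : ‖a.sum fun x r => r • kerAt H x‖ ^ 2
      = ∑ x ∈ a.support, ∑ y ∈ a.support, a x * a y * lam (x - y) := by
    rw [← real_inner_self_eq_norm_sq, Finsupp.sum, sum_inner]
    refine Finset.sum_congr rfl fun x _ => ?_
    rw [inner_sum]
    refine Finset.sum_congr rfl fun y _ => ?_
    rw [inner_smul_left, inner_smul_right, real_inner_comm, inner_kerAt, kerAt_apply h]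
    simp
    ring
  have hpi : (((2 * Real.pi) ^ d : ℝ) : ℂ) ≠ 0 := by
    exact_mod_cast (by positivity : (2 * Real.pi) ^ d ≠ 0)
  apply Complex.ofReal_injective
  rw [← integral_complex_ofReal, hn]
  simp_rw [hpt]
  rw [integral_finsetSum _ fun x _ => integrable_finsetSum _ fun y _ => hint x y]
  push_cast
  simp only [Finset.mul_sum]
  refine Finset.sum_congr rfl fun x _ => ?_
  rw [integral_finsetSum _ fun y _ => hint x y]
  refine Finset.sum_congr rfl fun y _ => ?_
  rw [integral_const_mul, hs.inversion, fourierInv]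
  push_cast at hpi ⊢
  field_simp

variable {P : E d → ℝ} {η : ℝ}

/-- Evaluating the inverse transform at finitely many points turns the linear form attached to
`preimage φ P` into a pairing with `trigPoly a`, to which Cauchy–Schwarz applies. -/
lemma sum_mul_preimage (hφ : IsDensity φ) (hσ : SpectrumContains φ η) (hP : Integrable P)
    (h0 : ∀ ξ ∉ cube d η, fourier P ξ = 0) (a : E d →₀ ℝ) :
    (a.sum fun x r => r * preimage φ P x)
      = ((((2 * Real.pi) ^ d : ℝ) : ℂ)⁻¹ * ∫ ξ, trigPoly a ξ * preimageFourier φ P ξ).re := by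
  have hG := integrable_preimageFourier hφ hσ hP h0
  have hint : ∀ x : E d, Integrable fun ξ =>
      Complex.exp (Complex.I * (inner ℝ x ξ : ℝ)) * preimageFourier φ P ξ := fun x =>
    hG.bdd_mul (c := 1) (by fun_prop : Continuous _).aestronglyMeasurable
      (Filter.Eventually.of_forall fun ξ => (norm_exp_I_mul _).le)
  simp only [trigPoly, Finsupp.sum, Finset.sum_mul, mul_assoc]
  rw [integral_finsetSum _ fun x _ => (hint x).const_mul _, Finset.mul_sum, Complex.re_sum]
  refine Finset.sum_congr rfl fun x _ => ?_
  rw [integral_const_mul, mul_left_comm, Complex.re_ofReal_mul, preimage_eq, fourierInv]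

/-- The norm of the preimage of `P` by `Φ` as a function of the reproducing kernel Hilbert
space. -/
lemma exists_RKHS_eq_preimage (hφ : IsDensity φ) (hσ : SpectrumContains φ η) (hP : Integrable P)
    (hPc : Continuous P) (h0 : ∀ ξ ∉ cube d η, fourier P ξ = 0) (h : HasKernel H lam)
    (hs : IsFourierTransformOf lam s) {ε : ℝ} (hε : 0 < ε)
    (hεs : ∀ ξ ∈ cube d η, ε ≤ sigma φ ξ ^ 2 * s ξ) :
    ∃ c : H, ‖c‖ ≤ √((∫ x, P x ^ 2) / ε) ∧ ∀ x, c x = preimage φ P x := by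
  refine exists_RKHS_of_forall_abs_le (Real.sqrt_nonneg _) fun a => ?_
  rw [sum_mul_preimage hφ hσ hP h0]
  have hFi := integrable_fourier hP h0
  have hpl := integral_norm_fourier_sq hP hPc hFi
  set u : E d → ℝ := fun ξ => ‖trigPoly a ξ‖ * √(s ξ) with hu
  set v : E d → ℝ := fun ξ => ‖fourier P ξ‖ with hv
  have hu2 : (fun ξ => u ξ ^ 2) = fun ξ => ‖trigPoly a ξ‖ ^ 2 * s ξ := by
    ext ξ
    rw [hu, mul_pow, Real.sq_sqrt (hs.nonneg ξ)]
  have hum : MemLp u 2 := by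
    rw [memLp_two_iff_integrable_sq, hu2]
    · exact integrable_norm_trigPoly_sq_mul hs a
    · exact ((continuous_trigPoly a).norm.measurable.mul
        hs.measurable.sqrt).aestronglyMeasurable
  have hFc := continuous_fourier hP
  have hvm : MemLp v 2 := by
    rw [memLp_two_iff_integrable_sq hFc.norm.aestronglyMeasurable]
    have := integrable_of_continuousOn_cube (g := fun ξ => ((‖fourier P ξ‖ ^ 2 : ℝ) : ℂ))
      (η := η) (by fun_prop) (fun ξ hξ => by simp [h0 ξ hξ])
    exact this.re.congr (Filter.Eventually.of_forall fun ξ => Complex.ofReal_re _)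
  have hCS : ∫ ξ, u ξ * v ξ ≤ √(∫ ξ, u ξ ^ 2) * √(∫ ξ, v ξ ^ 2) := by
    have := integral_mul_le_Lp_mul_Lq_of_nonneg (μ := (volume : Measure (E d)))
      Real.HolderConjugate.two_two (f := u) (g := v)
      (Filter.Eventually.of_forall fun ξ => by positivity)
      (Filter.Eventually.of_forall fun ξ => by positivity)
      (by simpa using hum) (by simpa using hvm)
    simpa [Real.sqrt_eq_rpow] using this
  rw [hu2, integral_norm_trigPoly_sq_mul h hs, hpl] at hCS
  -- On the cube `|σ| √s ≥ √ε`, so dividing by `σ` costs at most `√s / √ε`; off the cube the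
  -- integrand vanishes.
  have hle : ‖∫ ξ, trigPoly a ξ * preimageFourier φ P ξ‖ ≤ (√ε)⁻¹ * ∫ ξ, u ξ * v ξ := by
    rw [← integral_const_mul]
    refine norm_integral_le_of_norm_le ((hum.integrable_mul hvm).const_mul _)
      (Filter.Eventually.of_forall fun ξ => ?_)
    by_cases hξ : ξ ∈ cube d η
    · have hσξ : 0 < |sigma φ ξ| := abs_pos.2 (hσ ξ hξ)
      have h1 : √ε ≤ |sigma φ ξ| * √(s ξ) := by
        rw [← Real.sqrt_sq_eq_abs, ← Real.sqrt_mul (sq_nonneg _)]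
        exact Real.sqrt_le_sqrt (hεs ξ hξ)
      have hε' : 0 < √ε := Real.sqrt_pos.2 hε
      rw [norm_mul, preimageFourier, norm_div, Complex.norm_real, Real.norm_eq_abs,
        inv_mul_eq_div, mul_div_assoc', div_le_div_iff₀ hσξ hε']
      have := mul_le_mul_of_nonneg_left h1
        (mul_nonneg (norm_nonneg (trigPoly a ξ)) (norm_nonneg (fourier P ξ)))
      calc _ ≤ _ := this
        _ = _ := by simp only [hu, hv]; ring
    · simp [preimageFourier, h0 ξ hξ]
      positivity
  have hpi : (0 : ℝ) < (2 * Real.pi) ^ d := by positivity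
  refine (Complex.abs_re_le_norm _).trans ?_
  rw [norm_mul, norm_inv, Complex.norm_real, Real.norm_of_nonneg hpi.le, inv_mul_le_iff₀ hpi]
  refine (hle.trans (mul_le_mul_of_nonneg_left hCS (by positivity))).trans (le_of_eq ?_)
  -- Plancherel and the spectral norm each bring `√((2π)^d)`, which together cancel the
  -- normalization of the inverse transform.
  rw [Real.sqrt_mul hpi.le, Real.sqrt_mul hpi.le, Real.sqrt_sq (norm_nonneg _),
    Real.sqrt_div (integral_nonneg fun x => sq_nonneg (P x))]
  have := Real.mul_self_sqrt hpi.le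
  calc _ = (√((2 * Real.pi) ^ d) * √((2 * Real.pi) ^ d)) * (√(∫ x, P x ^ 2) / √ε *
      ‖a.sum fun x r => r • kerAt H x‖) := by ring
    _ = _ := by rw [this]

end RKHS

/-! ### The spectral infimum and the final constant. -/

section specInf

variable {φ s P : E d → ℝ} {m : ℕ}

/-- Finiteness ensures that passing to `toReal` keeps a positive infimum positive. -/
lemma specInf_lt_top (φ s : E d → ℝ) (m : ℕ) : specInf φ s m < ∞ := by
  refine (iInf₂_le (0 : E d) ?_).trans_lt ENNReal.ofReal_lt_top
  intro j
  simp

lemma toReal_specInf_le (hs : ∀ ξ, 0 ≤ s ξ) {ξ : E d} (hξ : ξ ∈ cube d (4 * m)) :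
    (specInf φ s m).toReal ≤ sigma φ ξ ^ 2 * s ξ :=
  ENNReal.toReal_le_of_le_ofReal (mul_nonneg (sq_nonneg _) (hs ξ)) (iInf₂_le ξ hξ)

lemma eLpNorm_two_sq (hP2 : Integrable fun x => P x ^ 2) :
    eLpNorm P 2 volume ^ 2 = ENNReal.ofReal (∫ x, P x ^ 2) := by
  rw [ofReal_integral_eq_lintegral_ofReal hP2 (Filter.Eventually.of_forall fun x => sq_nonneg _)]
  have h := eLpNorm_nnreal_pow_eq_lintegral (f := P) (μ := volume) (p := 2) two_ne_zero
  simp only [ENNReal.coe_ofNat, NNReal.coe_ofNat, ENNReal.rpow_ofNat] at h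
  rw [h]
  refine lintegral_congr fun x => ?_
  rw [Real.enorm_eq_ofReal_abs, ← sq_abs, ENNReal.ofReal_pow (abs_nonneg _)]

end specInf

section certificate

variable {m : ℕ} {t : Fin K → E d} {α : Fin K → ℝ} {β : Fin K → E d}

lemma cert_apply_self (hI : Interpolates m t α β) (k : Fin K) : cert m t α β (t k) = 1 := by
  rw [cert, (hI k).1, one_pow]

/-- Strict positivity excludes the quotient `0 / 0`, which would be `0` instead of `∞`, when the
spectral infimum vanishes. -/
lemma integral_cert_sq_pos (hK : 0 < K) (hI : Interpolates m t α β)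
    (h2 : Integrable fun x => cert m t α β x ^ 2) : 0 < ∫ x, cert m t α β x ^ 2 := by
  have hne : cert m t α β (t ⟨0, hK⟩) ^ 2 ≠ 0 := by
    rw [cert_apply_self hI]
    norm_num
  exact integral_pos_of_integrable_nonneg_nonzero ((continuous_cert m t α β).pow 2) h2
    (fun x => sq_nonneg _) hne

/-- The constant in the bound of the norm of the certificate. -/
noncomputable def certConst (d : ℕ) : ℝ := (2 * (1 + d)) ^ 2 * √(∫ u : E d, decay u ^ 4) + 1

/-- The summand `1` gives strict positivity without examining the integral of `decay ^ 4`. -/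
lemma certConst_pos (d : ℕ) : 0 < certConst d := by
  unfold certConst
  positivity

lemma sqrt_integral_cert_sq_le (hm : 0 < m) (hα : ∀ k, |α k| ≤ 2)
    (hβ : ∀ k j, |m * β k j| ≤ 2) :
    √(∫ x, cert m t α β x ^ 2)
      ≤ certConst d * ((K : ℝ) ^ 2 * (m : ℝ) ^ (-(d : ℝ) / 2)) := by
  have hm' : (0 : ℝ) < m := by exact_mod_cast hm
  have hJ : 0 ≤ ∫ u : E d, decay u ^ 4 :=
    integral_nonneg fun u => pow_nonneg (decay_nonneg u) 4
  have hmd : ((m : ℝ) ^ (-(d : ℝ) / 2)) ^ 2 = ((m : ℝ) ^ d)⁻¹ := by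
    rw [← Real.rpow_natCast, ← Real.rpow_mul hm'.le, ← Real.rpow_natCast, ← Real.rpow_neg hm'.le]
    congr 1
    push_cast
    ring
  have hle : (2 * (1 + d)) ^ 2 * √(∫ u : E d, decay u ^ 4) ≤ certConst d := by
    unfold certConst
    linarith
  refine le_trans ?_ (mul_le_mul_of_nonneg_right hle (by positivity))
  refine Real.sqrt_le_iff.2 ⟨by positivity, (integral_cert_sq_le hm hα hβ).trans (le_of_eq ?_)⟩
  have hring : ∀ a j k w : ℝ, (a ^ 2 * j * (k ^ 2 * w)) ^ 2 = a ^ 4 * j ^ 2 * (k ^ 4 * w ^ 2) :=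
    fun a j k w => by ring
  rw [hring, Real.sq_sqrt hJ, hmd]

end certificate

lemma ofReal_div_rpow_half {I : ℝ} (hI : 0 ≤ I) (S : ℝ≥0∞) :
    (ENNReal.ofReal I / S) ^ (1 / 2 : ℝ) = ENNReal.ofReal √I / S ^ (1 / 2 : ℝ) := by
  rw [ENNReal.div_rpow_of_nonneg _ _ (by norm_num), ENNReal.ofReal_rpow_of_nonneg hI (by norm_num),
    Real.sqrt_eq_rpow]

end Blasso

/-! ### Assembly of the two parts. -/

theorem proposition9 :
    -- the constant in the condition on `m` is universal
    ∃ C₀ : ℝ, 0 < C₀ ∧ ∀ d : ℕ, 0 < d →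
    -- the constant in the last inequality depends on the dimension only
    ∃ C : ℝ, 0 < C ∧
    -- the target measure
    ∀ (K : ℕ) (_ : 0 < K) (t : Fin K → E d) (_ : Function.Injective t)
      (a : Fin K → ℝ) (_ : ∀ k, 0 < a k) (_ : ∑ k, a k = 1)
    -- the dual certificate
      (m : ℕ) (_ : 0 < m) (_ : C₀ * Real.sqrt K * (d : ℝ) ^ (3 / 2 : ℝ) / sepPlus t ≤ m)
      (α : Fin K → ℝ) (β : Fin K → E d) (_ : Interpolates m t α β)
    -- the kernels `φ` and `lam`, and the reproducing kernel Hilbert space of `lam (x - y)`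
      (φ lam : E d → ℝ) (_ : IsDensity φ) (_ : IsPosDefKernel φ)
      (_ : SpectrumContains φ (4 * m)) (_ : IsPosDefKernel lam)
      (H : Type*) [NormedAddCommGroup H] [InnerProductSpace ℝ H] [CompleteSpace H]
      [RKHS ℝ H (E d) ℝ] (_ : HasKernel H lam),
    -- `P_m = Φ c₀`, and part i)
    (∀ c₀ : H, (∀ x, c₀ x = preimage φ (cert m t α β) x) →
      (∀ x, cert m t α β x = convFun φ c₀ x) ∧
      ∀ (Ω : Type*) [MeasurableSpace Ω] (Pr : Measure Ω) [IsProbabilityMeasure Pr]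
        (X : ℕ → Ω → E d) (_ : ∀ i, Measurable (X i)) (_ : iIndepFun X Pr)
        (_ : ∀ i, Pr.map (X i) =
          volume.withDensity fun x => ENNReal.ofReal (mixtureDensity φ a t x))
        (ρ : ℕ → ℝ) (_ : ∀ n, 1 ≤ n → 0 < ρ n)
        (_ : ∀ n, 1 ≤ n →
          ∫ ω, ‖L H (empirical n fun i => X i ω) - L H (Phi φ (mixing a t))‖ ^ 2 ∂Pr ≤ ρ n ^ 2)
        (μhat : ℕ → Ω → SignedMeasure (E d))
        (_ : ∀ n, 1 ≤ n → ∀ ω,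
          IsBlasso φ (L H (empirical n fun i => X i ω)) (ρ n / ‖c₀‖) (μhat n ω)),
        ∀ n, 1 ≤ n →
          Integrable (fun ω => bregman (cert m t α β) (μhat n ω) (mixing a t)) Pr ∧
          ∫ ω, bregman (cert m t α β) (μhat n ω) (mixing a t) ∂Pr
            ≤ 3 * Real.sqrt 2 / 2 * ρ n * ‖c₀‖) ∧
    -- part ii), where `s = F[lam]`
    ∀ s : E d → ℝ, IsFourierTransformOf lam s →
      (0 < specInf φ s m → ∃ c₀ : H, ∀ x, c₀ x = preimage φ (cert m t α β) x) ∧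
      (∀ c₀ : H, (∀ x, c₀ x = preimage φ (cert m t α β) x) →
        ENNReal.ofReal ‖c₀‖
          ≤ (eLpNorm (cert m t α β) 2 volume ^ 2 / specInf φ s m) ^ (1 / 2 : ℝ)) ∧
      (eLpNorm (cert m t α β) 2 volume ^ 2 / specInf φ s m) ^ (1 / 2 : ℝ)
        ≤ ENNReal.ofReal C * constCm K φ s m := by
  refine ⟨64, by norm_num, fun d hd => ⟨certConst d, certConst_pos d, ?_⟩⟩
  intro K hK t ht a _ _ m hm hsep α β hI φ lam hφ hφ' hσ hl H _ _ _ _ h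
  obtain ⟨hα, hβ⟩ := coeff_le_two hd hK ht hm hsep hI
  have hP := integrable_cert (t := t) hm hα hβ
  have hPc := continuous_cert m t α β
  have hP2 := integrable_cert_sq (t := t) hm hα hβ
  have h0 : ∀ ξ ∉ cube d (4 * m), fourier (cert m t α β) ξ = 0 := fun ξ hξ =>
    fourier_cert_eq_zero hm hα hβ hξ
  have hI0 : 0 ≤ ∫ x, cert m t α β x ^ 2 := integral_nonneg fun x => sq_nonneg _
  refine ⟨fun c₀ hc₀ => ?_, fun s hs => ?_⟩
  · have hc : ∀ x, cert m t α β x = convFun φ c₀ x := fun x => by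
      rw [show (c₀ : E d → ℝ) = preimage φ (cert m t α β) from funext hc₀,
        convFun_preimage hφ hφ' hσ hP hPc h0]
    refine ⟨hc, ?_⟩
    intro Ω _ Pr _ X hX _ _ ρ hρ hΓ μhat hμ n hn
    -- A zero preimage would give `P_m = 0`, contradicting `P_m(t_k) = 1`; this makes `κ = ρ / ‖c₀‖`
    -- positive.
    have hc0 : c₀ ≠ 0 := by
      rintro rfl
      have := hc (t ⟨0, hK⟩)
      rw [cert_apply_self hI] at this
      simp [convFun] at this
    obtain ⟨h1, h2⟩ := integral_bregman_le hφ hφ' hl h hPc (abs_cert_le hα hβ) hc0 hc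
      (mixing a t) Pr (stronglyMeasurable_L_empirical hl h n hX)
      (fun ω => norm_L_empirical_le hl h hn _) (hρ n hn) (hΓ n hn) (μhat n) (hμ n hn)
    refine ⟨h1, h2.trans ?_⟩
    -- Equivalent to `2 ≤ 3√2/2`, which passes from the constant obtained to the one claimed.
    have h3 : (4 / 3 : ℝ) ≤ √2 := Real.le_sqrt_of_sq_le (by norm_num)
    have h4 : 0 ≤ ρ n * ‖c₀‖ := mul_nonneg (hρ n hn).le (norm_nonneg _)
    nlinarith
  · have hex : 0 < specInf φ s m → ∃ c : H,
        ‖c‖ ≤ √((∫ x, cert m t α β x ^ 2) / (specInf φ s m).toReal) ∧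
        ∀ x, c x = preimage φ (cert m t α β) x := fun hpos =>
      exists_RKHS_eq_preimage hφ hσ hP hPc h0 h hs
        (ENNReal.toReal_pos hpos.ne' (specInf_lt_top φ s m).ne)
        fun ξ hξ => toReal_specInf_le hs.nonneg hξ
    rw [eLpNorm_two_sq hP2]
    refine ⟨fun hpos => (hex hpos).imp fun c hc => hc.2, fun c₀ hc₀ => ?_, ?_⟩
    · rcases eq_or_ne (specInf φ s m) 0 with hz | hz
      · have hne : ENNReal.ofReal (∫ x, cert m t α β x ^ 2) ≠ 0 :=
          (ENNReal.ofReal_pos.2 (integral_cert_sq_pos hK hI hP2)).ne'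
        rw [hz, ENNReal.div_zero hne, ENNReal.top_rpow_of_pos (by norm_num)]
        exact le_top
      · obtain ⟨c, hcn, hc⟩ := hex (pos_iff_ne_zero.2 hz)
        -- An element of the RKHS is determined by its values, so the norm bound on the constructed
        -- preimage applies to `c₀`.
        have hcc : c₀ = c := RKHS.ext fun x => (hc₀ x).trans (hc x).symm
        have hpos := ENNReal.toReal_pos hz (specInf_lt_top φ s m).ne
        rw [hcc, ← ENNReal.ofReal_toReal (specInf_lt_top φ s m).ne,
          ← ENNReal.ofReal_div_of_pos hpos, ENNReal.ofReal_rpow_of_nonneg (by positivity)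
          (by norm_num), ← Real.sqrt_eq_rpow]
        exact ENNReal.ofReal_le_ofReal hcn
    · rw [ofReal_div_rpow_half hI0, constCm, ← mul_div_assoc,
        ← ENNReal.ofReal_mul (certConst_pos d).le]
      exact ENNReal.div_le_div_right
        (ENNReal.ofReal_le_ofReal (sqrt_integral_cert_sq_le hm hα hβ)) _
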